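/- Consider the stochastic bilevel continuous knapsack problem $$\text{(SP)}\qquad \max_{b\in[b^-,b^+]}\ \hat f(b),\qquad \hat f(b):=\mathbb{E}_{c}\bigl(d^\top x^{c}(b)-\delta b\bigr),\qquad x^{c}(b)\in\operatorname{argmax}\{c^\top x : a^\top x\le b,\ x\in[0,1]^n\},$$ with $n\ge 1$ items, item sizes $a\in\mathbb{Z}_{>0}^n$, leader's item values $d\in\mathbb{Z}^n$, a price $\delta\ge 0$ and capacity bounds $0\le b^-\le b^+\le A$, where $A:=\sum_{i=1}^n a_i$ and $D:=\sum_{i=1}^n|d_i|$. The vector $c$ of the follower's item values is a random vector in $\mathbb{R}^n$ with arbitrary (continuous, discrete or mixed) distribution such that its components $c_1,\dots,c_n$ are independent, and such that $\mathbb{P}(c_i/a_i=c_j/a_j)=0$ for $i\ne j$ and $\mathbb{P}(c_i=0)=0$ for all $i$; thus the follower's optimal solution is almost surely unique and $\hat f$ does not depend on how ties are broken. The distribution of $c$ is accessible only through oracles, which can be queried in constant time, for the cumulative distribution functions $F_i(\gamma)=\mathbb{P}(c_i\le\gamma)$, $\gamma\in\mathbb{R}$, and the quantile functions $Q_i(p)=\inf\{\gamma\in\mathbb{R}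 : p\le F_i(\gamma)\}$, $0<p<1$. Then (SP) has a fully pseudo-polynomial time additive approximation scheme. More precisely, there are a single algorithm (a program for a random-access machine with unit-cost exact real arithmetic and comparisons, without rounding operations, and with these oracles) and a constant $C$ such that, for every such instance and every $\varepsilon>0$, the algorithm, given $n,a,d,\delta,b^-,b^+,\varepsilon$ and the oracles, computes some $\tilde b\in[b^-,b^+]$ with $$\hat f(\tilde b)\ \ge\ \hat f(b)-\varepsilon\qquad\text{for all } b\in[b^-,b^+]$$ in time at most $C\,\bigl(n^3A+\tfrac1\varepsilon\, n^4A^2D\bigr)$; in particular, in time $O(\tfrac1\varepsilon n^4A^2D)$ whenever $\varepsilon\le nAD$. -/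

import Mathlib

open MeasureTheory ProbabilityTheory

/-! ### Real random-access machines with oracles

Programs work on two kinds of memory: arrays of natural numbers (used for counters and addresses)
and arrays of real numbers. A program refers to finitely many arrays by fixed names; cells are
addressed by computed indices (indirect addressing). On natural numbers the machine has addition
and truncated subtraction; on reals it has the four field operations and exact comparison, but no
rounding; program constants are natural numbers. Two families of oracles, each taking an item
index and a real number and returning a real number, can be queried. Every elementary operation,
memory access, test and oracle query costs one time unit. -/

namespace RealRAM

/-- A memory configuration: `nat k j` and `real k j` are the contents of cell `j` of the
natural-number array, respectively real array, with name `k`. -/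
structure State where
  nat : ℕ → ℕ → ℕ
  real : ℕ → ℕ → ℝ

/-- Natural-number expressions. -/
inductive NExp where
  | const (k : ℕ)
  | load (k : ℕ) (idx : NExp)
  | add (e₁ e₂ : NExp)
  | sub (e₁ e₂ : NExp)

/-- Real expressions. `cdf i x` and `quantile i p` are oracle queries for item `i`. -/
inductive RExp where
  | ofNat (e : NExp)
  | load (k : ℕ) (idx : NExp)
  | add (r₁ r₂ : RExp)
  | sub (r₁ r₂ : RExp)
  | mul (r₁ r₂ : RExp)
  | div (r₁ r₂ : RExp)
  | cdf (i : NExp) (x : RExp)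
  | quantile (i : NExp) (p : RExp)

/-- Tests. -/
inductive BExp where
  | nlt (e₁ e₂ : NExp)
  | rlt (r₁ r₂ : RExp)
  | not (t : BExp)
  | and (t₁ t₂ : BExp)

/-- Programs: assignment to a cell of an array, sequential composition, branching and
while-loops. -/
inductive Program where
  | nop
  | nset (k : ℕ) (idx : NExp) (e : NExp)
  | rset (k : ℕ) (idx : NExp) (r : RExp)
  | seq (p q : Program)
  | branch (t : BExp) (p q : Program)
  | loop (t : BExp) (p : Program)

/-- Number of operations needed to evaluate a natural-number expression. -/
def NExp.cost : NExp → ℕ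
  | .const _ => 1
  | .load _ idx => idx.cost + 1
  | .add e₁ e₂ => e₁.cost + e₂.cost + 1
  | .sub e₁ e₂ => e₁.cost + e₂.cost + 1

/-- Number of operations and oracle queries needed to evaluate a real expression. -/
def RExp.cost : RExp → ℕ
  | .ofNat e => e.cost + 1
  | .load _ idx => idx.cost + 1
  | .add r₁ r₂ => r₁.cost + r₂.cost + 1
  | .sub r₁ r₂ => r₁.cost + r₂.cost + 1
  | .mul r₁ r₂ => r₁.cost + r₂.cost + 1
  | .div r₁ r₂ => r₁.cost + r₂.cost + 1
  | .cdf i x => i.cost + x.cost + 1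
  | .quantile i p => i.cost + p.cost + 1

/-- Number of operations needed to evaluate a test. -/
def BExp.cost : BExp → ℕ
  | .nlt e₁ e₂ => e₁.cost + e₂.cost + 1
  | .rlt r₁ r₂ => r₁.cost + r₂.cost + 1
  | .not t => t.cost + 1
  | .and t₁ t₂ => t₁.cost + t₂.cost + 1

/-- Value of a natural-number expression. -/
def NExp.eval (s : State) : NExp → ℕ
  | .const k => k
  | .load k idx => s.nat k (idx.eval s)
  | .add e₁ e₂ => e₁.eval s + e₂.eval s
  | .sub e₁ e₂ => e₁.eval s - e₂.eval s

/-- Value of a real expression, where `F` and `Q` are the oracles; a division by zero returns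
zero. -/
noncomputable def RExp.eval (F Q : ℕ → ℝ → ℝ) (s : State) : RExp → ℝ
  | .ofNat e => (e.eval s : ℝ)
  | .load k idx => s.real k (idx.eval s)
  | .add r₁ r₂ => r₁.eval F Q s + r₂.eval F Q s
  | .sub r₁ r₂ => r₁.eval F Q s - r₂.eval F Q s
  | .mul r₁ r₂ => r₁.eval F Q s * r₂.eval F Q s
  | .div r₁ r₂ => r₁.eval F Q s / r₂.eval F Q s
  | .cdf i x => F (i.eval s) (x.eval F Q s)
  | .quantile i p => Q (i.eval s) (p.eval F Q s)

/-- Outcome of a test. -/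
def BExp.holds (F Q : ℕ → ℝ → ℝ) (s : State) : BExp → Prop
  | .nlt e₁ e₂ => e₁.eval s < e₂.eval s
  | .rlt r₁ r₂ => r₁.eval F Q s < r₂.eval F Q s
  | .not t => ¬ t.holds F Q s
  | .and t₁ t₂ => t₁.holds F Q s ∧ t₂.holds F Q s

/-- Overwrite cell `j` of the natural-number array `k` by `v`. -/
def State.setNat (s : State) (k j v : ℕ) : State :=
  { s with nat := Function.update s.nat k (Function.update (s.nat k) j v) }

/-- Overwrite cell `j` of the real array `k` by `v`. -/
noncomputable def State.setReal (s : State) (k j : ℕ) (v : ℝ) : State :=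
  { s with real := Function.update s.real k (Function.update (s.real k) j v) }

/-- `Exec F Q p s t s'`: with oracles `F` and `Q`, the program `p` started in the memory
configuration `s` halts in the configuration `s'` after `t` time units. -/
inductive Exec (F Q : ℕ → ℝ → ℝ) : Program → State → ℕ → State → Prop where
  | nop (s : State) : Exec F Q .nop s 1 s
  | nset (s : State) (k : ℕ) (idx e : NExp) :
      Exec F Q (.nset k idx e) s (idx.cost + e.cost + 1) (s.setNat k (idx.eval s) (e.eval s))
  | rset (s : State) (k : ℕ) (idx : NExp) (r : RExp) :
      Exec F Q (.rset k idx r) s (idx.cost + r.cost + 1)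
        (s.setReal k (idx.eval s) (r.eval F Q s))
  | seq {p q : Program} {s s' s'' : State} {t t' : ℕ}
      (hp : Exec F Q p s t s') (hq : Exec F Q q s' t' s'') :
      Exec F Q (.seq p q) s (t + t') s''
  | branch_true {c : BExp} {p q : Program} {s s' : State} {t : ℕ}
      (hc : c.holds F Q s) (hp : Exec F Q p s t s') :
      Exec F Q (.branch c p q) s (c.cost + t) s'
  | branch_false {c : BExp} {p q : Program} {s s' : State} {t : ℕ}
      (hc : ¬ c.holds F Q s) (hq : Exec F Q q s t s') :
      Exec F Q (.branch c p q) s (c.cost + t) s'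
  | loop_false {c : BExp} {p : Program} {s : State}
      (hc : ¬ c.holds F Q s) :
      Exec F Q (.loop c p) s c.cost s
  | loop_true {c : BExp} {p : Program} {s s' s'' : State} {t t' : ℕ}
      (hc : c.holds F Q s) (hp : Exec F Q p s t s') (hl : Exec F Q (.loop c p) s' t' s'') :
      Exec F Q (.loop c p) s (c.cost + t + t') s''

end RealRAM

/-! ### The stochastic bilevel continuous knapsack problem -/

namespace BilevelKnapsack

/-- The deterministic data of the problem with `n` items: item sizes `a`, the leader's item values
`d`, the price `δ` per unit of capacity, and the capacity bounds `bLo ≤ bHi`. -/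
structure Data (n : ℕ) where
  a : Fin n → ℕ
  d : Fin n → ℤ
  δ : ℝ
  bLo : ℝ
  bHi : ℝ
  a_pos : ∀ i, 0 < a i
  δ_nonneg : 0 ≤ δ
  bLo_nonneg : 0 ≤ bLo
  bLo_le_bHi : bLo ≤ bHi
  bHi_le : bHi ≤ ((∑ i, a i : ℕ) : ℝ)

variable {n : ℕ}

/-- The total item size `A = ∑ aᵢ`. -/
def Data.A (K : Data n) : ℕ := ∑ i, K.a i

/-- The total absolute leader's value `D = ∑ |dᵢ|`. -/
def Data.D (K : Data n) : ℤ := ∑ i, |K.d i|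

/-- The follower's feasible set for capacity `b`: fractional packings `x ∈ [0,1]ⁿ` with
`aᵀx ≤ b`. -/
def Data.feasible (K : Data n) (b : ℝ) : Set (Fin n → ℝ) :=
  {x | (∀ i, 0 ≤ x i ∧ x i ≤ 1) ∧ ∑ i, (K.a i : ℝ) * x i ≤ b}

/-- The follower's set of optimal solutions for item values `c` and capacity `b`. -/
def Data.followerArgmax (K : Data n) (c : Fin n → ℝ) (b : ℝ) : Set (Fin n → ℝ) :=
  {x | x ∈ K.feasible b ∧ ∀ y ∈ K.feasible b, ∑ i, c i * y i ≤ ∑ i, c i * x i}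

/-- `x` is a response of the follower: for all item values `c` and all capacities `b` that the
leader may choose, `x c b` is an optimal solution of the follower's problem. -/
def Data.IsResponse (K : Data n) (x : (Fin n → ℝ) → ℝ → Fin n → ℝ) : Prop :=
  ∀ c, ∀ b ∈ Set.Icc K.bLo K.bHi, x c b ∈ K.followerArgmax c b

/-- The leader's objective value `dᵀ x^c(b) - δ b` for follower's item values `c`. -/
noncomputable def Data.value (K : Data n) (x : (Fin n → ℝ) → ℝ → Fin n → ℝ) (b : ℝ)
    (c : Fin n → ℝ) : ℝ :=
  ∑ i, (K.d i : ℝ) * x c b i - K.δ * b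

/-- The leader's expected objective value for capacity `b`, where the random vector `c` of
follower's item values has law `ν`. -/
noncomputable def Data.expectedValue (K : Data n) (ν : Measure (Fin n → ℝ))
    (x : (Fin n → ℝ) → ℝ → Fin n → ℝ) (b : ℝ) : ℝ :=
  ∫ c, K.value x b c ∂ν

/-- Almost surely, the profits `cᵢ / aᵢ` are pairwise distinct and nonzero. -/
def Data.Generic (K : Data n) (ν : Measure (Fin n → ℝ)) : Prop :=
  (∀ i j, i ≠ j → ν {c | c i / (K.a i : ℝ) = c j / (K.a j : ℝ)} = 0) ∧
    ∀ i, ν {c | c i = 0} = 0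

/-- The distribution of the `i`-th component under the law `ν`. -/
noncomputable def marginal (ν : Measure (Fin n → ℝ)) (i : Fin n) : Measure ℝ :=
  ν.map (fun c => c i)

/-- The quantile function `p ↦ inf {x | p ≤ F(x)}` of a distribution on the real line with
cumulative distribution function `F` (meaningful for `0 < p < 1`). -/
noncomputable def quantile (μ : Measure ℝ) (p : ℝ) : ℝ :=
  sInf {x : ℝ | p ≤ cdf μ x}

/-- `F` is an oracle for the cumulative distribution functions of the components. -/
def IsCdfOracle (ν : Measure (Fin n → ℝ)) (F : ℕ → ℝ → ℝ) : Prop :=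
  ∀ (i : Fin n) (x : ℝ), F i x = cdf (marginal ν i) x

/-- `Q` is an oracle for the quantile functions of the components; nothing is known about the
answers to queries outside of `(0,1)`. -/
def IsQuantileOracle (ν : Measure (Fin n → ℝ)) (Q : ℕ → ℝ → ℝ) : Prop :=
  ∀ (i : Fin n), ∀ p ∈ Set.Ioo (0 : ℝ) 1, Q i p = quantile (marginal ν i) p

/-- The initial memory: the natural-number array `0` holds `n`, the natural-number array `1` holds
the item sizes, the real array `0` holds `δ, bLo, bHi, ε`, and the real array `1` holds the
leader's item values. All other cells are zero. -/
noncomputable def Data.input (K : Data n) (ε : ℝ) : RealRAM.State where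
  nat k j :=
    if k = 0 ∧ j = 0 then n
    else if h : k = 1 ∧ j < n then K.a ⟨j, h.2⟩
    else 0
  real k j :=
    if k = 0 ∧ j = 0 then K.δ
    else if k = 0 ∧ j = 1 then K.bLo
    else if k = 0 ∧ j = 2 then K.bHi
    else if k = 0 ∧ j = 3 then ε
    else if h : k = 1 ∧ j < n then (K.d ⟨j, h.2⟩ : ℝ)
    else 0

/-- The output of a computation is the content of cell `0` of the real array `2`. -/
def output (s : RealRAM.State) : ℝ := s.real 2 0

end BilevelKnapsack

/-! Almost surely the profits `c i / a i` are distinct and nonzero, and the follower packs greedily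
(`eq_greedy`): an item with `c i > 0` receives the projection to [0,1] of (b - L)/aᵢ, where L is the
total size of the items of larger profit; items of negative value receive nothing. Since L is an
integer, the expected objective is affine in b between consecutive integers. A maximum over [b⁻,b⁺]
is thus attained at the projection to that interval of one of 0, …, A (`greedyValue_le_integer`).

For fixed b, linearity reduces the objective to the expected amount of each item i. Independence
permits conditioning on cᵢ = γ (`integral_condition`). Then the events that j precedes i are
independent with probabilities 1 - Fⱼ(aⱼγ/aᵢ), so a dynamic program over the used capacity computes
the conditional expectation exactly (`packDP_eq_integral`). As a function of γ it is monotone with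
values in [0,1], because a larger γ only moves i forward. Averaging it over the quantiles at k/N, 0
< k < N, therefore errs by at most 1/N (`sum_quantile_le_integral`), even for distributions with
atoms. The total error at each b is at most D/N.

With N = ⌈2D/ε⌉ this is at most ε/2, so an exact maximizer of the approximate objective over the A+1
candidates is ε-optimal. If 2D ≤ ε, the lower bound b⁻ is already good enough. The nested loops over
capacities, items, quantiles, stages and table cells cost O(n²A²N).

The program is verified in a Hoare-style calculus with time bounds (`Run`), where `Frame` lists the
arrays that may have changed; `schemeProgram_run` is its outcome. -/

namespace RealRAM

/-! ### Time-bounded total correctness -/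

/-- Started in `s`, the program halts within `T` time units in a configuration satisfying
`post`. -/
def Run (F Q : ℕ → ℝ → ℝ) (p : Program) (s : State) (T : ℕ) (post : State → Prop) : Prop :=
  ∃ t s', Exec F Q p s t s' ∧ t ≤ T ∧ post s'

/-- Outside the natural-number arrays `N` and the real arrays `R`, the configurations `s` and `s'`
agree. -/
structure Frame (N R : List ℕ) (s s' : State) : Prop where
  nat : ∀ k, k ∉ N → s'.nat k = s.nat k
  real : ∀ k, k ∉ R → s'.real k = s.real k

theorem State.setNat_nat (s : State) (k j v k' j' : ℕ) :
    (s.setNat k j v).nat k' j' = if k' = k ∧ j' = j then v else s.nat k' j' := by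
  by_cases hk : k' = k
  · subst hk; by_cases hj : j' = j <;> simp [State.setNat, hj]
  · simp [State.setNat, hk]

theorem State.setNat_nat_of_ne (s : State) {k k' : ℕ} (j v : ℕ) (h : k' ≠ k) :
    (s.setNat k j v).nat k' = s.nat k' := by
  simp [State.setNat, h]

@[simp] theorem State.setNat_real (s : State) (k j v : ℕ) : (s.setNat k j v).real = s.real := rfl

theorem State.setReal_real (s : State) (k j : ℕ) (v : ℝ) (k' j' : ℕ) :
    (s.setReal k j v).real k' j' = if k' = k ∧ j' = j then v else s.real k' j' := by
  by_cases hk : k' = k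
  · subst hk; by_cases hj : j' = j <;> simp [State.setReal, hj]
  · simp [State.setReal, hk]

theorem State.setReal_real_of_ne (s : State) {k k' : ℕ} (j : ℕ) (v : ℝ) (h : k' ≠ k) :
    (s.setReal k j v).real k' = s.real k' := by
  simp [State.setReal, h]

@[simp] theorem State.setReal_nat (s : State) (k j : ℕ) (v : ℝ) : (s.setReal k j v).nat = s.nat :=
  rfl

theorem Frame.refl (N R : List ℕ) (s : State) : Frame N R s s := ⟨fun _ _ => rfl, fun _ _ => rfl⟩

theorem Frame.trans {N R : List ℕ} {s s' s'' : State} (h : Frame N R s s') (h' : Frame N R s' s'') :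
    Frame N R s s'' :=
  ⟨fun k hk => (h'.nat k hk).trans (h.nat k hk), fun k hk => (h'.real k hk).trans (h.real k hk)⟩

theorem Frame.mono {N R N' R' : List ℕ} {s s' : State} (h : Frame N R s s') (hN : N ⊆ N')
    (hR : R ⊆ R') : Frame N' R' s s' :=
  ⟨fun k hk => h.nat k fun hk' => hk (hN hk'), fun k hk => h.real k fun hk' => hk (hR hk')⟩

theorem Frame.setNat {N R : List ℕ} {s s' : State} (h : Frame N R s s') {k : ℕ} (j v : ℕ)
    (hk : k ∈ N) : Frame N R s (s'.setNat k j v) :=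
  ⟨fun k' hk' => by
    rw [State.setNat_nat_of_ne _ _ _ (by rintro rfl; exact hk' hk), h.nat k' hk'], h.real⟩

theorem Frame.setReal {N R : List ℕ} {s s' : State} (h : Frame N R s s') {k : ℕ} (j : ℕ) (v : ℝ)
    (hk : k ∈ R) : Frame N R s (s'.setReal k j v) :=
  ⟨h.nat, fun k' hk' => by
    rw [State.setReal_real_of_ne _ _ _ (by rintro rfl; exact hk' hk), h.real k' hk']⟩

section rules

variable {F Q : ℕ → ℝ → ℝ} {s : State} {post : State → Prop}

theorem Run.mono {p : Program} {T T' : ℕ} {post' : State → Prop} (h : Run F Q p s T post)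
    (hT : T ≤ T') (hp : ∀ s', post s' → post' s') : Run F Q p s T' post' := by
  obtain ⟨t, s', he, ht, hs⟩ := h
  exact ⟨t, s', he, ht.trans hT, hp _ hs⟩

theorem Run.nop (h : post s) : Run F Q .nop s 1 post := ⟨1, s, .nop s, le_rfl, h⟩

theorem Run.nset {k : ℕ} {idx e : NExp} (h : post (s.setNat k (idx.eval s) (e.eval s))) :
    Run F Q (.nset k idx e) s (idx.cost + e.cost + 1) post :=
  ⟨_, _, .nset s k idx e, le_rfl, h⟩

theorem Run.rset {k : ℕ} {idx : NExp} {r : RExp}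
    (h : post (s.setReal k (idx.eval s) (r.eval F Q s))) :
    Run F Q (.rset k idx r) s (idx.cost + r.cost + 1) post :=
  ⟨_, _, .rset s k idx r, le_rfl, h⟩

/-- Placing the run of `q` in the postcondition of `p` gives a weakest-precondition style:
intermediate states need not be named. -/
theorem Run.seq {p q : Program} {T T' : ℕ} (h : Run F Q p s T fun s' => Run F Q q s' T' post) :
    Run F Q (.seq p q) s (T + T') post := by
  obtain ⟨t, s', he, ht, t', s'', he', ht', hs⟩ := h
  exact ⟨_, s'', .seq he he', Nat.add_le_add ht ht', hs⟩

theorem Run.branch {c : BExp} {p q : Program} {T : ℕ}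
    (hp : c.holds F Q s → Run F Q p s T post) (hq : ¬ c.holds F Q s → Run F Q q s T post) :
    Run F Q (.branch c p q) s (c.cost + T) post := by
  by_cases hc : c.holds F Q s
  · obtain ⟨t, s', he, ht, hs⟩ := hp hc
    exact ⟨_, s', .branch_true hc he, by omega, hs⟩
  · obtain ⟨t, s', he, ht, hs⟩ := hq hc
    exact ⟨_, s', .branch_false hc he, by omega, hs⟩

/-- The invariant is indexed by the iteration number and decides the test, so the number of
iterations is exactly `M`. This yields termination and time bound at once, by induction on the
remaining iterations. -/
theorem Run.loop {c : BExp} {p : Program} {T M : ℕ} (I : ℕ → State → Prop)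
    (hstep : ∀ m < M, ∀ s, I m s → c.holds F Q s ∧ Run F Q p s T (I (m + 1)))
    (hend : ∀ s, I M s → ¬ c.holds F Q s) (h0 : I 0 s) :
    Run F Q (.loop c p) s (M * (c.cost + T) + c.cost) (I M) := by
  have key : ∀ k m, m + k = M → ∀ s, I m s →
      Run F Q (.loop c p) s (k * (c.cost + T) + c.cost) (I M) := by
    intro k
    induction k with
    | zero =>
      rintro m rfl s hs
      exact ⟨_, s, .loop_false (hend s hs), by simp, hs⟩
    | succ k ih =>
      intro m hm s hs
      obtain ⟨hc, t, s', he, ht, hs'⟩ := hstep m (by omega) s hs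
      obtain ⟨t', s'', he', ht', hs''⟩ := ih (m + 1) (by omega) s' hs'
      exact ⟨_, s'', .loop_true hc he he', by rw [Nat.succ_mul]; omega, hs''⟩
  exact key M 0 (by omega) s h0

/-- The natural-number variable stored in cell `0` of array `k`. -/
abbrev nvar (k : ℕ) : NExp := .load k (.const 0)

/-- The real variable stored in cell `0` of array `k`. -/
abbrev rvar (k : ℕ) : RExp := .load k (.const 0)

/-- Assignment to a real variable. -/
abbrev rassign (k : ℕ) (r : RExp) : Program := .rset k (.const 0) r

/-- Run `body` with the variable `v` counting from `0` up to `bound - 1`. -/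
def forLoop (v : ℕ) (bound : NExp) (body : Program) : Program :=
  .seq (.nset v (.const 0) (.const 0))
    (.loop (.nlt (nvar v) bound)
      (.seq body (.nset v (.const 0) (.add (nvar v) (.const 1)))))

/-- The bound is re-evaluated before each iteration, hence the invariant must fix its value. Per
iteration, 9 accounts for the test without the bound (3) and the increment (6); the final 6 is the
initialization and the last test. -/
theorem Run.forLoop {v M T : ℕ} {bound : NExp} {body : Program} (I : ℕ → State → Prop)
    (h0 : I 0 (s.setNat v 0 0))
    (hI : ∀ m s, I m s → s.nat v 0 = m ∧ bound.eval s = M)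
    (hstep : ∀ m < M, ∀ s, I m s →
      Run F Q body s T fun s' => s'.nat v 0 = m ∧ I (m + 1) (s'.setNat v 0 (m + 1))) :
    Run F Q (forLoop v bound body) s (M * (T + bound.cost + 9) + bound.cost + 6) (I M) := by
  have h1 : Run F Q (.loop (.nlt (nvar v) bound)
      (.seq body (.nset v (.const 0) (.add (nvar v) (.const 1))))) (s.setNat v 0 0)
      (M * ((BExp.nlt (nvar v) bound).cost + (T + 6)) + (BExp.nlt (nvar v) bound).cost) (I M) := by
    refine Run.loop I (fun m hm s hs => ⟨?_, ?_⟩) (fun s hs => ?_) h0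
    · obtain ⟨h2, h3⟩ := hI m s hs
      simpa [BExp.holds, NExp.eval, h2, h3] using hm
    · refine Run.seq ((hstep m hm s hs).mono le_rfl fun s' ⟨h2, h3⟩ => ?_)
      exact Run.nset (by simpa [NExp.eval, h2] using h3)
    · obtain ⟨h2, h3⟩ := hI M s hs
      simp [BExp.holds, NExp.eval, h2, h3]
  refine (Run.seq (Run.nset (h1 : _))).mono (le_of_eq ?_) fun _ h => h
  simp only [NExp.cost, BExp.cost]
  ring

end rules

end RealRAM

namespace BilevelKnapsack

open RealRAM

/-! ### The algorithm -/

/-- Projection of a real number to the unit interval. -/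
noncomputable def clampUnit (x : ℝ) : ℝ := max 0 (min 1 x)

/-- The probability that item `j` has a larger profit than item `i` when the latter has value `γ`
(and `0` for `j = i`). -/
noncomputable def precedeProb (F : ℕ → ℝ → ℝ) (a : ℕ → ℕ) (i : ℕ) (γ : ℝ) (j : ℕ) : ℝ :=
  if j = i then 0 else 1 - F j (a j * γ / a i)

/-- Dynamic program for the expected amount of item `i` packed if it has value `γ`, a capacity of
`s` is already used, and only the first `m` items may precede item `i`. -/
noncomputable def packDP (F : ℕ → ℝ → ℝ) (a : ℕ → ℕ) (b : ℝ) (i : ℕ) (γ : ℝ) : ℕ → ℕ → ℝ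
  | 0, s => clampUnit ((b - s) / a i)
  | m + 1, s => precedeProb F a i γ m * packDP F a b i γ m (s + a m) +
      (1 - precedeProb F a i γ m) * packDP F a b i γ m s

/-- Expected amount of item `i` packed if it has value `γ`. -/
noncomputable def packed (F : ℕ → ℝ → ℝ) (a : ℕ → ℕ) (n : ℕ) (b : ℝ) (i : ℕ) (γ : ℝ) : ℝ :=
  if 0 < γ then packDP F a b i γ n 0 else 0

/-- Approximate objective value computed by the algorithm with quantiles at multiples of `1/N`. -/
noncomputable def approxValue (F Q : ℕ → ℝ → ℝ) (a : ℕ → ℕ) (d : ℕ → ℝ) (δ : ℝ) (n N : ℕ)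
    (b : ℝ) : ℝ :=
  -(δ * b) + ∑ i ∈ Finset.range n, ∑ k ∈ Finset.range (N - 1),
    d i * packed F a n b i (Q i (((k + 1 : ℕ) : ℝ) / N)) / N

/-- Fill the array of initial values of the dynamic program. -/
def initProgram : Program :=
  -- Memory layout. Natural arrays: 0 is n, 1 is a, 2 is A, 3 is N; 4 to 8 are the counters for
  -- capacity, item, quantile, stage and used capacity. Real arrays: 0 holds the parameters, 1 is d,
  -- 2 the best capacity, 3 is D, 4 the current b, 5 the value γ, 6 the table of the dynamic
  -- program, 7 the accumulated objective, 8 the best objective, 9 the probability of preceding.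
  forLoop 8 (.add (nvar 2) (.const 1))
    (.seq (.rset 6 (nvar 8)
        (.div (.sub (rvar 4) (.ofNat (nvar 8))) (.ofNat (.load 1 (nvar 5)))))
      (.branch (.rlt (.load 6 (nvar 8)) (.ofNat (.const 0)))
        (.rset 6 (nvar 8) (.ofNat (.const 0)))
        (.branch (.rlt (.ofNat (.const 1)) (.load 6 (nvar 8)))
          (.rset 6 (nvar 8) (.ofNat (.const 1))) .nop)))

/-- One stage of the dynamic program, for a fixed item. -/
def stageProgram : Program :=
  .seq
    -- Only `<` can be tested, so equality of the two indices is a pair of negated comparisons.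
    (.branch (.and (.not (.nlt (nvar 7) (nvar 5))) (.not (.nlt (nvar 5) (nvar 7))))
      (rassign 9 (.ofNat (.const 0)))
      (rassign 9 (.sub (.ofNat (.const 1)) (.cdf (nvar 7)
        (.div (.mul (.ofNat (.load 1 (nvar 7))) (rvar 5)) (.ofNat (.load 1 (nvar 5))))))))
    (forLoop 8 (.add (nvar 2) (.const 1))
      (.rset 6 (nvar 8)
        (.add (.mul (rvar 9) (.load 6 (.add (nvar 8) (.load 1 (nvar 7)))))
          (.mul (.sub (.ofNat (.const 1)) (rvar 9)) (.load 6 (nvar 8))))))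

/-- The dynamic program. -/
def dpProgram : Program := forLoop 7 (nvar 0) stageProgram

/-- Add the contribution of the current item and the current quantile to the objective value. -/
def quantileProgram : Program :=
  .seq (rassign 5 (.quantile (nvar 5)
      (.div (.ofNat (.add (nvar 6) (.const 1))) (.ofNat (nvar 3)))))
    (.branch (.rlt (.ofNat (.const 0)) (rvar 5))
      (.seq initProgram (.seq dpProgram
        (rassign 7 (.add (rvar 7)
          (.div (.mul (.load 1 (nvar 5)) (.load 6 (.const 0))) (.ofNat (nvar 3)))))))
      .nop)

/-- Add the contribution of the current item. -/
def itemProgram : Program := forLoop 6 (.sub (nvar 3) (.const 1)) quantileProgram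

/-- Compute the approximate objective value of the current capacity. -/
def valueProgram : Program :=
  .seq (rassign 7 (.sub (.ofNat (.const 0)) (.mul (rvar 0) (rvar 4))))
    (forLoop 5 (nvar 0) itemProgram)

/-- Determine the capacity to be considered. -/
def capacityProgram : Program :=
  .seq (rassign 4 (.ofNat (nvar 4)))
    (.branch (.rlt (rvar 4) (.load 0 (.const 1)))
      (rassign 4 (.load 0 (.const 1)))
      (.branch (.rlt (.load 0 (.const 2)) (rvar 4)) (rassign 4 (.load 0 (.const 2))) .nop))

/-- Update the best capacity found so far. -/
def updateProgram : Program :=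
  .branch (.not (.and (.not (.nlt (nvar 4) (.const 1))) (.not (.rlt (rvar 8) (rvar 7)))))
    (.seq (rassign 8 (rvar 7)) (rassign 2 (rvar 4))) .nop

/-- Maximize the approximate objective value. -/
def searchProgram : Program :=
  forLoop 4 (.add (nvar 2) (.const 1))
    (.seq capacityProgram (.seq valueProgram updateProgram))

/-- Compute the total item size and the total absolute leader's value. -/
def sumProgram : Program :=
  forLoop 5 (nvar 0)
    (.seq (.nset 2 (.const 0) (.add (nvar 2) (.load 1 (nvar 5))))
      (.branch (.rlt (.load 1 (nvar 5)) (.ofNat (.const 0)))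
        (rassign 3 (.sub (rvar 3) (.load 1 (nvar 5))))
        (rassign 3 (.add (rvar 3) (.load 1 (nvar 5))))))

/-- Compute the number of quantiles to be used. -/
def countProgram : Program :=
  .loop (.rlt (.mul (.ofNat (nvar 3)) (.load 0 (.const 3))) (.add (rvar 3) (rvar 3)))
    (.nset 3 (.const 0) (.add (nvar 3) (.const 1)))

/-- The approximation scheme. -/
def schemeProgram : Program :=
  .seq sumProgram
    (.branch (.rlt (.load 0 (.const 3)) (.add (rvar 3) (rvar 3)))
      (.seq countProgram searchProgram)
      (rassign 2 (.load 0 (.const 1))))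

theorem clampUnit_eq_zero {x : ℝ} (h : x ≤ 0) : clampUnit x = 0 := by
  simp [clampUnit, h]

theorem clampUnit_eq_one {x : ℝ} (h : 1 ≤ x) : clampUnit x = 1 := by
  simp [clampUnit, h]

theorem clampUnit_eq_self {x : ℝ} (h0 : 0 ≤ x) (h1 : x ≤ 1) : clampUnit x = x := by
  simp [clampUnit, h0, h1]

/-- Once the capacity is used up, nothing more is packed. As b ≤ A, table cells beyond A are zero at
every stage, so the reads at `s + a m` need no bounds check. -/
theorem packDP_eq_zero (F : ℕ → ℝ → ℝ) (a : ℕ → ℕ) {b : ℝ} (i : ℕ) (γ : ℝ) (m : ℕ) :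
    ∀ s : ℕ, b ≤ s → packDP F a b i γ m s = 0 := by
  induction m with
  | zero =>
    intro s hs
    exact clampUnit_eq_zero (div_nonpos_of_nonpos_of_nonneg (by linarith) (Nat.cast_nonneg _))
  | succ m ih =>
    intro s hs
    rw [packDP, ih s hs, ih (s + a m) (by push_cast; linarith [(a m).cast_nonneg (α := ℝ)])]
    simp

/-! ### Correctness and cost of the dynamic program -/

section verification

variable {F Q : ℕ → ℝ → ℝ}

theorem initProgram_run {s : State} {A : ℕ} (hA : s.nat 2 0 = A) (hb : s.real 4 0 ≤ A)
    (hz : ∀ j, A < j → s.real 6 j = 0) :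
    Run F Q initProgram s (60 * (A + 1) + 10) fun s' => Frame [8] [6] s s' ∧
      ∀ j : ℕ, s'.real 6 j = clampUnit ((s.real 4 0 - j) / s.nat 1 (s.nat 5 0)) := by
  set f : ℕ → ℝ := fun j => clampUnit ((s.real 4 0 - j) / s.nat 1 (s.nat 5 0)) with hf
  refine (Run.forLoop (M := A + 1) (T := 40) (fun m s' => Frame [8] [6] s s' ∧ s'.nat 8 0 = m ∧
    (∀ j < m, s'.real 6 j = f j) ∧ ∀ j, A < j → s'.real 6 j = 0) ?_ ?_ ?_).mono ?_ ?_
  · refine ⟨(Frame.refl _ _ s).setNat _ _ (by simp), by simp [State.setNat_nat], by simp, ?_⟩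
    simpa using hz
  · rintro m s' ⟨hfr, hm, -, -⟩
    refine ⟨hm, ?_⟩
    simp [NExp.eval, hfr.nat 2 (by simp), hA]
  · rintro m hm s' ⟨hfr, h8, hlt, hgt⟩
    have e4 := hfr.real 4 (by simp)
    have e1 := hfr.nat 1 (by simp)
    have e5 := hfr.nat 5 (by simp)
    -- The three outcomes of the clamping differ only in the value finally stored in cell `m`; the
    -- remaining bookkeeping is shared.
    have main : ∀ v, v = f m → ∀ s'', Frame [8] [6] s' s'' → s''.nat = s'.nat →
        (s''.real 6 = Function.update (s'.real 6) m v) → s''.nat 8 0 = m ∧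
        Frame [8] [6] s (s''.setNat 8 0 (m + 1)) ∧ (s''.setNat 8 0 (m + 1)).nat 8 0 = m + 1 ∧
        (∀ j < m + 1, (s''.setNat 8 0 (m + 1)).real 6 j = f j) ∧
        ∀ j, A < j → (s''.setNat 8 0 (m + 1)).real 6 j = 0 := by
      intro v hv s'' hfr' hn h6
      refine ⟨by rw [hn, h8], (hfr.trans hfr').setNat _ _ (by simp), by simp [State.setNat_nat],
        fun j hj => ?_, fun j hj => ?_⟩
      · rcases eq_or_ne j m with rfl | hne
        · simp [h6, hv]
        · simp [h6, hne, hlt j (by omega)]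
      · simp [h6, show j ≠ m by omega, hgt j hj]
    refine (Run.seq (Run.rset (Run.branch (T := 14) (fun h => ?_) (fun h => ?_)))).mono ?_
      fun _ h => h
    rotate_left 2
    · decide
    all_goals
      simp only [BExp.holds, RExp.eval, NExp.eval, h8, State.setReal_nat, State.setReal_real, e4,
        e1, e5, and_self, if_true, Nat.cast_zero] at h
    · refine (Run.rset (main 0 ?_ _ ?_ ?_ ?_)).mono (by decide) fun _ h => h
      · rw [hf]; exact (clampUnit_eq_zero h.le).symm
      · exact ((Frame.refl _ _ _).setReal _ _ (by simp)).setReal _ _ (by simp)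
      · rfl
      · simp [State.setReal, NExp.eval, RExp.eval, h8]
    · refine (Run.branch (T := 5) (fun h' => ?_) (fun h' => ?_)).mono (by decide) fun _ h => h
      all_goals
        simp only [BExp.holds, RExp.eval, NExp.eval, h8, State.setReal_nat, State.setReal_real, e4,
          e1, e5, and_self, if_true, Nat.cast_one] at h'
      · refine (Run.rset (main 1 ?_ _ ?_ ?_ ?_)).mono (by decide) fun _ h => h
        · rw [hf]; exact (clampUnit_eq_one h'.le).symm
        · exact ((Frame.refl _ _ _).setReal _ _ (by simp)).setReal _ _ (by simp)
        · rfl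
        · simp [State.setReal, NExp.eval, RExp.eval, h8]
      · refine (Run.nop (main (f m) rfl _ ?_ ?_ ?_)).mono (by decide) fun _ h => h
        · exact ((Frame.refl _ _ _).setReal _ _ (by simp))
        · rfl
        · rw [show f m = _ from clampUnit_eq_self (not_lt.1 h) (not_lt.1 h')]
          simp [State.setReal, NExp.eval, RExp.eval, h8, e4, e1, e5]
  · simp only [NExp.cost]; omega
  · rintro s' ⟨hfr, -, hlt, hgt⟩
    refine ⟨hfr, fun j => ?_⟩
    rcases lt_or_ge j (A + 1) with hj | hj
    · exact hlt j hj
    · rw [hgt j (by omega)]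
      have : (A : ℝ) ≤ j := by exact_mod_cast (by omega : A ≤ j)
      exact (clampUnit_eq_zero (div_nonpos_of_nonpos_of_nonneg (by linarith)
        (Nat.cast_nonneg _))).symm

/-- The table is updated in place with increasing index. The two cells read, `r` and `r + aⱼ`, lie
at or after the cell being written, so both still hold values of the previous stage. -/
theorem stageProgram_run {s : State} {A j : ℕ} {g : ℕ → ℝ} (hA : s.nat 2 0 = A)
    (hz : ∀ r, A < r → g r = 0) (h6 : s.real 6 = g) (hj : s.nat 7 0 = j) (ha : 0 < s.nat 1 j) :
    Run F Q stageProgram s (60 * (A + 1) + 50) fun s' => Frame [8] [6, 9] s s' ∧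
      ∀ r, s'.real 6 r =
        precedeProb F (s.nat 1) (s.nat 5 0) (s.real 5 0) j * g (r + s.nat 1 j) +
        (1 - precedeProb F (s.nat 1) (s.nat 5 0) (s.real 5 0) j) * g r := by
  set p := precedeProb F (s.nat 1) (s.nat 5 0) (s.real 5 0) j with hp
  have hloop : ∀ s₁ : State, s₁.nat = s.nat → Frame [8] [6, 9] s s₁ → s₁.real 9 0 = p →
      s₁.real 6 = g →
      Run F Q (forLoop 8 (.add (nvar 2) (.const 1))
      (.rset 6 (nvar 8)
        (.add (.mul (rvar 9) (.load 6 (.add (nvar 8) (.load 1 (nvar 7)))))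
          (.mul (.sub (.ofNat (.const 1)) (rvar 9)) (.load 6 (nvar 8))))))
      s₁ (60 * (A + 1) + 10) fun s' => Frame [8] [6, 9] s s' ∧
        ∀ r, s'.real 6 r = p * g (r + s.nat 1 j) + (1 - p) * g r := by
    intro s₁ hn hfr₁ h9 h61
    refine (Run.forLoop (M := A + 1) (T := 40) (fun m s' => Frame [8] [6, 9] s s' ∧
      s'.real 9 0 = p ∧ s'.nat 8 0 = m ∧
      (∀ r < m, s'.real 6 r = p * g (r + s.nat 1 j) + (1 - p) * g r) ∧
      ∀ r, m ≤ r → s'.real 6 r = g r) ?_ ?_ ?_).mono ?_ ?_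
    · refine ⟨hfr₁.setNat _ _ (by simp), by simpa using h9, by simp [State.setNat_nat], by simp, ?_⟩
      simp [h61]
    · rintro m s' ⟨hfr, -, hm, -, -⟩
      refine ⟨hm, ?_⟩
      simp [NExp.eval, hfr.nat 2 (by simp), hA]
    · rintro m hm s' ⟨hfr, h9', h8, hlt, hge⟩
      have e1 := hfr.nat 1 (by simp)
      have e7 := hfr.nat 7 (by simp)
      refine (Run.rset ?_).mono (by decide) fun _ h => h
      refine ⟨by simp [h8], (hfr.setReal _ _ (by simp)).setNat _ _ (by simp), ?_, ?_, ?_, ?_⟩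
      · simpa [State.setReal_real] using h9'
      · simp [State.setNat_nat]
      · intro r hr
        rcases eq_or_ne r m with rfl | hne
        · simp [State.setReal_real, NExp.eval, RExp.eval, h8, h9', e1, e7, hj, hge]
        · simp [State.setReal_real, NExp.eval, h8, hne, hlt r (by omega)]
      · intro r hr
        simp [State.setReal_real, NExp.eval, h8, show r ≠ m by omega, hge r (by omega)]
    · simp only [NExp.cost]; omega
    · rintro s' ⟨hfr, -, -, hlt, hge⟩
      refine ⟨hfr, fun r => ?_⟩
      rcases lt_or_ge r (A + 1) with hr | hr
      · exact hlt r hr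
      · rw [hge r hr, hz r (by omega), hz (r + s.nat 1 j) (by omega)]
        simp
  refine (Run.seq (T := 40) (T' := 60 * (A + 1) + 10) ((Run.branch (T := 20) (fun h => ?_)
    (fun h => ?_)).mono (by decide) fun _ h => h)).mono (by omega) fun _ h => h
  all_goals
    simp only [BExp.holds, NExp.eval, hj] at h
  · refine (Run.rset (hloop _ (State.setReal_nat _ _ _ _) ?_ ?_ ?_)).mono (by decide) fun _ h => h
    · exact (Frame.refl _ _ _).setReal _ _ (by simp)
    · simp [State.setReal_real, NExp.eval, RExp.eval, hp, precedeProb, show j = s.nat 5 0 by omega]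
    · rw [State.setReal_real_of_ne _ _ _ (by simp), h6]
  · refine (Run.rset (hloop _ (State.setReal_nat _ _ _ _) ?_ ?_ ?_)).mono (by decide) fun _ h => h
    · exact (Frame.refl _ _ _).setReal _ _ (by simp)
    · simp [State.setReal_real, NExp.eval, RExp.eval, hp, precedeProb,
        show j ≠ s.nat 5 0 by omega, hj]
    · rw [State.setReal_real_of_ne _ _ _ (by simp), h6]

theorem dpProgram_run {s : State} {n A : ℕ} {b : ℝ} (hn : s.nat 0 0 = n) (hA : s.nat 2 0 = A)
    (hb : b ≤ A) (ha : ∀ j < n, 0 < s.nat 1 j)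
    (h6 : s.real 6 = packDP F (s.nat 1) b (s.nat 5 0) (s.real 5 0) 0) :
    Run F Q dpProgram s (n * (60 * (A + 1) + 61) + 8) fun s' => Frame [7, 8] [6, 9] s s' ∧
      s'.real 6 = packDP F (s.nat 1) b (s.nat 5 0) (s.real 5 0) n := by
  refine (Run.forLoop (M := n) (T := 60 * (A + 1) + 50) (fun m s' => Frame [7, 8] [6, 9] s s' ∧
      s'.nat 7 0 = m ∧ s'.real 6 = packDP F (s.nat 1) b (s.nat 5 0) (s.real 5 0) m)
      ?_ ?_ ?_).mono ?_ ?_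
  · exact ⟨(Frame.refl _ _ s).setNat _ _ (by simp), by simp [State.setNat_nat], h6⟩
  · rintro m s' ⟨hfr, hm, -⟩
    exact ⟨hm, by simp [NExp.eval, hfr.nat 0 (by simp), hn]⟩
  · rintro m hm s' ⟨hfr, h7, h6'⟩
    have e1 := hfr.nat 1 (by simp)
    have e2 := hfr.nat 2 (by simp)
    have e5 := hfr.nat 5 (by simp)
    have r5 := hfr.real 5 (by simp)
    refine (stageProgram_run (e2 ▸ hA) (fun r hr => ?_) h6' h7 (by rw [e1]; exact ha m hm)).mono
      le_rfl ?_
    · exact packDP_eq_zero _ _ _ _ _ _ (hb.trans (by exact_mod_cast hr.le))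
    · rintro s'' ⟨hfr', h6''⟩
      refine ⟨by rw [hfr'.nat 7 (by simp), h7],
        (hfr.trans (hfr'.mono (by simp) (by simp))).setNat _ _ (by simp),
        by simp [State.setNat_nat], ?_⟩
      funext r
      simp [h6'', e1, e5, r5, packDP]
  · simp only [NExp.cost]; apply le_of_eq; ring
  · rintro s' ⟨hfr, -, h⟩
    exact ⟨hfr, h⟩

end verification

end BilevelKnapsack

namespace BilevelKnapsack

open RealRAM

/-- The memory configurations in which the search phase of the algorithm works: the input and the
numbers `A` and `N` are stored, and the array of the dynamic program vanishes beyond `A`. -/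
structure Ready (n A N : ℕ) (a : ℕ → ℕ) (par d : ℕ → ℝ) (s : State) : Prop where
  nat0 : s.nat 0 0 = n
  nat1 : s.nat 1 = a
  nat2 : s.nat 2 0 = A
  nat3 : s.nat 3 0 = N
  real0 : s.real 0 = par
  real1 : s.real 1 = d
  real6 : ∀ j, A < j → s.real 6 j = 0

theorem Ready.frame {n A N : ℕ} {a : ℕ → ℕ} {par d : ℕ → ℝ} {s s' : State}
    (h : Ready n A N a par d s) {I R : List ℕ} (hf : Frame I R s s')
    (hI : ∀ k < 4, k ∉ I) (hR : ∀ k < 2, k ∉ R) (h6 : ∀ j, A < j → s'.real 6 j = 0) :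
    Ready n A N a par d s' where
  nat0 := by rw [hf.nat 0 (hI 0 (by simp)), h.nat0]
  nat1 := by rw [hf.nat 1 (hI 1 (by simp)), h.nat1]
  nat2 := by rw [hf.nat 2 (hI 2 (by simp)), h.nat2]
  nat3 := by rw [hf.nat 3 (hI 3 (by simp)), h.nat3]
  real0 := by rw [hf.real 0 (hR 0 (by simp)), h.real0]
  real1 := by rw [hf.real 1 (hR 1 (by simp)), h.real1]
  real6 := h6

/-! ### Correctness and cost of the quantile sums, the search and the whole scheme -/

section verification

variable {F Q : ℕ → ℝ → ℝ} {n A N : ℕ} {a : ℕ → ℕ} {par d : ℕ → ℝ}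

theorem quantileProgram_run {s : State} (hs : Ready n A N a par d s) (ha : ∀ j < n, 0 < a j)
    (hb : s.real 4 0 ≤ A) :
    Run F Q quantileProgram s (60 * (A + 1) + n * (60 * (A + 1) + 61) + 70) fun s' =>
      Frame [7, 8] [5, 6, 7, 9] s s' ∧ (∀ j, A < j → s'.real 6 j = 0) ∧
      s'.real 7 0 = s.real 7 0 + d (s.nat 5 0) * packed F a n (s.real 4 0) (s.nat 5 0)
        (Q (s.nat 5 0) (((s.nat 6 0 + 1 : ℕ) : ℝ) / N)) / N := by
  set i := s.nat 5 0 with hi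
  set γ := Q i (((s.nat 6 0 + 1 : ℕ) : ℝ) / N) with hγ
  set b := s.real 4 0 with hb'
  refine (Run.seq (T := 20) (T' := 60 * (A + 1) + n * (60 * (A + 1) + 61) + 50)
    ((Run.rset ?_).mono (by decide) fun _ h => h)).mono (by omega) fun _ h => h
  set s₁ : State := s.setReal 5 ((NExp.const 0).eval s) _ with hs₁
  have f₁ : Frame [7, 8] [5, 6, 7, 9] s s₁ := (Frame.refl _ _ _).setReal _ _ (by simp)
  have g₁ : s₁.real 5 0 = γ := by
    simp [hs₁, State.setReal_real, NExp.eval, RExp.eval, hγ, hi, hs.nat3]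
  have z₁ : ∀ j, A < j → s₁.real 6 j = 0 := by
    rw [hs₁, State.setReal_real_of_ne _ _ _ (by simp)]; exact hs.real6
  have a₁ : s₁.real 7 0 = s.real 7 0 := by
    rw [hs₁, State.setReal_real_of_ne _ _ _ (by simp)]
  have hs1 : Ready n A N a par d s₁ := hs.frame f₁ (by decide) (by decide) z₁
  have i₁ : s₁.nat 5 0 = i := rfl
  have b₁ : s₁.real 4 0 = b := by rw [f₁.real 4 (by simp)]
  refine (Run.branch (T := 60 * (A + 1) + n * (60 * (A + 1) + 61) + 40)
    (fun h => ?_) (fun h => ?_)).mono (by simp only [BExp.cost, RExp.cost, NExp.cost]; omega)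
    fun _ h => h
  all_goals
    simp only [BExp.holds, NExp.eval, RExp.eval, g₁, Nat.cast_zero] at h
  · refine (Run.seq (T := 60 * (A + 1) + 10) (T' := n * (60 * (A + 1) + 61) + 8 + 22)
      ((initProgram_run hs1.nat2 (by rw [b₁]; exact hb) z₁).mono le_rfl ?_)).mono (by omega)
      fun _ h => h
    rintro s₂ ⟨f₂, v₂⟩
    refine Run.seq ((dpProgram_run (A := A) (b := b) (n := n) ?_ ?_ hb ?_ ?_).mono le_rfl ?_)
    · rw [f₂.nat 0 (by simp), hs1.nat0]
    · rw [f₂.nat 2 (by simp), hs1.nat2]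
    · rw [f₂.nat 1 (by simp), hs1.nat1]; exact ha
    · funext r
      rw [v₂, f₂.nat 1 (by simp), f₂.nat 5 (by simp), b₁, packDP]
    · rintro s₃ ⟨f₃, v₃⟩
      rw [f₂.nat 1 (by simp), f₂.nat 5 (by simp), f₂.real 5 (by simp), g₁, hs1.nat1, i₁] at v₃
      have f₄ : Frame [7, 8] [5, 6, 7, 9] s s₃ :=
        (f₁.trans (f₂.mono (by simp) (by simp))).trans (f₃.mono (by simp) (by simp))
      refine (Run.rset ⟨f₄.setReal _ _ (by simp), fun j hj => ?_, ?_⟩).mono (by decide)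
        fun _ h => h
      -- The finished table again vanishes beyond A, so the next quantile needs no clean-up.
      · rw [State.setReal_real_of_ne _ _ _ (by simp), v₃]
        exact packDP_eq_zero _ _ _ _ _ _ (hb.trans (by exact_mod_cast hj.le))
      · have e7 : s₃.real 7 0 = s.real 7 0 := by
          rw [f₃.real 7 (by simp), f₂.real 7 (by simp), a₁]
        simp [State.setReal_real, NExp.eval, RExp.eval, e7, f₄.real 1 (by simp), hs.real1, v₃,
          f₄.nat 3 (by simp), f₄.nat 5 (by simp), hs.nat3, packed, h, ← hi]
  · refine (Run.nop ⟨f₁, z₁, ?_⟩).mono (by omega) fun _ h => h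
    rw [a₁, packed, if_neg h]
    simp

theorem itemProgram_run {s : State} (hs : Ready n A N a par d s) (ha : ∀ j < n, 0 < a j)
    (hb : s.real 4 0 ≤ A) :
    Run F Q itemProgram s
      ((N - 1) * (60 * (A + 1) + n * (60 * (A + 1) + 61) + 83) + 10) fun s' =>
      Frame [6, 7, 8] [5, 6, 7, 9] s s' ∧ (∀ j, A < j → s'.real 6 j = 0) ∧
      s'.real 7 0 = s.real 7 0 + ∑ k ∈ Finset.range (N - 1),
        d (s.nat 5 0) * packed F a n (s.real 4 0) (s.nat 5 0)
        (Q (s.nat 5 0) (((k + 1 : ℕ) : ℝ) / N)) / N := by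
  refine (Run.forLoop (M := N - 1) (T := 60 * (A + 1) + n * (60 * (A + 1) + 61) + 70)
    (fun m s' => s'.nat 6 0 = m ∧ Frame [6, 7, 8] [5, 6, 7, 9] s s' ∧
      (∀ j, A < j → s'.real 6 j = 0) ∧
      s'.real 7 0 = s.real 7 0 + ∑ k ∈ Finset.range m,
        d (s.nat 5 0) * packed F a n (s.real 4 0) (s.nat 5 0)
        (Q (s.nat 5 0) (((k + 1 : ℕ) : ℝ) / N)) / N) ?_ ?_ ?_).mono ?_ ?_
  · exact ⟨by simp [State.setNat_nat], (Frame.refl _ _ s).setNat _ _ (by simp), hs.real6, by simp⟩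
  · rintro m s' ⟨h6, hf, -⟩
    exact ⟨h6, by simp [NExp.eval, hf.nat 3 (by simp), hs.nat3]⟩
  · rintro m hm s' ⟨h6, hf, hz, h7⟩
    have hs' := hs.frame hf (by decide) (by decide) hz
    have e4 := hf.real 4 (by simp)
    have e5 := hf.nat 5 (by simp)
    refine (quantileProgram_run hs' ha (e4 ▸ hb)).mono le_rfl ?_
    rintro s'' ⟨hf', hz', h7'⟩
    refine ⟨by rw [hf'.nat 6 (by simp), h6], by simp [State.setNat_nat],
      (hf.trans (hf'.mono (by simp) (by simp))).setNat _ _ (by simp), hz', ?_⟩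
    rw [State.setNat_real, h7', h7, Finset.sum_range_succ, e4, e5, h6, add_assoc]
  · simp only [NExp.cost]
    linarith
  · rintro s' ⟨-, h⟩
    exact h

theorem valueProgram_run {s : State} (hs : Ready n A N a par d s) (ha : ∀ j < n, 0 < a j)
    (hb : s.real 4 0 ≤ A) :
    Run F Q valueProgram s
      (n * ((N - 1) * (60 * (A + 1) + n * (60 * (A + 1) + 61) + 83) + 21) + 20) fun s' =>
      Frame [5, 6, 7, 8] [5, 6, 7, 9] s s' ∧ (∀ j, A < j → s'.real 6 j = 0) ∧
      s'.real 7 0 = approxValue F Q a d (par 0) n N (s.real 4 0) := by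
  refine (Run.seq (Run.rset ((Run.forLoop (M := n)
    (T := (N - 1) * (60 * (A + 1) + n * (60 * (A + 1) + 61) + 83) + 10)
    (fun m s' => s'.nat 5 0 = m ∧ Frame [5, 6, 7, 8] [5, 6, 7, 9] s s' ∧
      (∀ j, A < j → s'.real 6 j = 0) ∧
      s'.real 7 0 = -(par 0 * s.real 4 0) + ∑ i ∈ Finset.range m, ∑ k ∈ Finset.range (N - 1),
        d i * packed F a n (s.real 4 0) i (Q i (((k + 1 : ℕ) : ℝ) / N)) / N)
      ?_ ?_ ?_).mono le_rfl ?_))).mono ?_ fun _ h => h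
  · refine ⟨by simp [State.setNat_nat],
      ((Frame.refl _ _ s).setReal _ _ (by simp)).setNat _ _ (by simp), ?_, ?_⟩
    · simpa [State.setReal_real] using hs.real6
    · simp [State.setReal_real, NExp.eval, RExp.eval, hs.real0]
  · rintro m s' ⟨h5, hf, -⟩
    exact ⟨h5, by simp [NExp.eval, hf.nat 0 (by simp), hs.nat0]⟩
  · rintro m hm s' ⟨h5, hf, hz, h7⟩
    have hs' := hs.frame hf (by decide) (by decide) hz
    have e4 := hf.real 4 (by simp)
    refine (itemProgram_run hs' ha (e4 ▸ hb)).mono le_rfl ?_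
    rintro s'' ⟨hf', hz', h7'⟩
    refine ⟨by rw [hf'.nat 5 (by simp), h5], by simp [State.setNat_nat],
      (hf.trans (hf'.mono (by simp) (by simp))).setNat _ _ (by simp), hz', ?_⟩
    rw [State.setNat_real, h7', h7, Finset.sum_range_succ, e4, h5, add_assoc]
  · rintro s' ⟨-, hf, hz, h7⟩
    exact ⟨hf, hz, h7⟩
  · simp only [NExp.cost, RExp.cost]; linarith

theorem capacityProgram_run {s : State} (hlo : par 1 ≤ par 2) (h0 : s.real 0 = par) :
    Run F Q capacityProgram s 30 fun s' => Frame [] [4] s s' ∧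
      s'.real 4 0 = max (par 1) (min (s.nat 4 0) (par 2)) := by
  refine (Run.seq (Run.rset (Run.branch (T := 15) (fun h => ?_) fun h =>
    (Run.branch (T := 5) (fun h' => ?_) fun h' => ?_).mono (by decide) fun _ h => h))).mono
    (by decide) fun _ h => h
  all_goals
    simp [BExp.holds, NExp.eval, RExp.eval, State.setReal_real, h0] at h
  · refine (Run.rset ⟨((Frame.refl _ _ _).setReal _ _ (by simp)).setReal _ _ (by simp), ?_⟩).mono
      (by decide) fun _ h => h
    simp [NExp.eval, RExp.eval, State.setReal_real, h0, h.le]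
  all_goals
    simp [BExp.holds, NExp.eval, RExp.eval, State.setReal_real, h0] at h'
  · refine (Run.rset ⟨((Frame.refl _ _ _).setReal _ _ (by simp)).setReal _ _ (by simp), ?_⟩).mono
      (by decide) fun _ h => h
    simp [NExp.eval, RExp.eval, State.setReal_real, h0, hlo, h'.le]
  · refine (Run.nop ⟨((Frame.refl _ _ _).setReal _ _ (by simp)), ?_⟩).mono
      (by decide) fun _ h => h
    simp [NExp.eval, RExp.eval, State.setReal_real, h, h']

/-- Here `e k` is the `k`-th candidate and `f k` its value. Before the first candidate there is no
incumbent, whence the guard `0 < m`; the program then updates unconditionally. -/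
theorem updateProgram_run {s : State} {m : ℕ} (f : ℕ → ℝ) (e : ℕ → ℝ) (h4 : s.nat 4 0 = m)
    (hm : 0 < m → ∃ k < m, s.real 2 0 = e k ∧ s.real 8 0 = f k ∧ ∀ r < m, f r ≤ f k)
    (h7 : s.real 7 0 = f m) (h4' : s.real 4 0 = e m) :
    Run F Q updateProgram s 30 fun s' => Frame [] [2, 8] s s' ∧
      ∃ k < m + 1, s'.real 2 0 = e k ∧ s'.real 8 0 = f k ∧ ∀ r < m + 1, f r ≤ f k := by
  refine (Run.branch (T := 15) (fun h => ?_) fun h => ?_).mono (by decide) fun _ h => h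
  all_goals
    simp only [BExp.holds, NExp.eval, RExp.eval, h4, h7] at h
  · refine (Run.seq (Run.rset (Run.rset ⟨((Frame.refl _ _ _).setReal _ _ (by simp)).setReal _ _
      (by simp), m, by omega, ?_, ?_, ?_⟩))).mono (by decide) fun _ h => h
    · simp [NExp.eval, RExp.eval, State.setReal_real, h4']
    · simp [NExp.eval, RExp.eval, State.setReal_real, h7]
    · intro r hr
      rcases eq_or_ne r m with rfl | hne
      · exact le_rfl
      · obtain ⟨k, hk, -, h8, hmax⟩ := hm (by omega)
        have h8' : s.real 8 0 < f m := by
          by_contra hc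
          exact h ⟨by omega, hc⟩
        exact (hmax r (by omega)).trans (by linarith)
  · rw [not_not] at h
    obtain ⟨k, hk, h2, h8, hmax⟩ := hm (by omega)
    refine (Run.nop ⟨Frame.refl _ _ _, k, by omega, h2, h8, fun r hr => ?_⟩).mono (by decide)
      fun _ h => h
    rcases eq_or_ne r m with rfl | hne
    · exact h8 ▸ not_lt.1 h.2
    · exact hmax r (by omega)

theorem searchProgram_run {s : State} (hs : Ready n A N a par d s) (ha : ∀ j < n, 0 < a j)
    (hlo : par 1 ≤ par 2) (hhi : par 2 ≤ A) :
    Run F Q searchProgram s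
      ((A + 1) * (n * ((N - 1) * (60 * (A + 1) + n * (60 * (A + 1) + 61) + 83) + 21) + 94) + 10)
      fun s' => ∃ k < A + 1, s'.real 2 0 = max (par 1) (min (k : ℝ) (par 2)) ∧ ∀ r < A + 1,
        approxValue F Q a d (par 0) n N (max (par 1) (min (r : ℝ) (par 2))) ≤
          approxValue F Q a d (par 0) n N (max (par 1) (min (k : ℝ) (par 2))) := by
  set e : ℕ → ℝ := fun k => max (par 1) (min (k : ℝ) (par 2)) with he
  set f : ℕ → ℝ := fun k => approxValue F Q a d (par 0) n N (e k) with hf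
  refine (Run.forLoop (M := A + 1)
    (T := n * ((N - 1) * (60 * (A + 1) + n * (60 * (A + 1) + 61) + 83) + 21) + 80)
    (fun m s' => s'.nat 4 0 = m ∧ Frame [4, 5, 6, 7, 8] [2, 4, 5, 6, 7, 8, 9] s s' ∧
      (∀ j, A < j → s'.real 6 j = 0) ∧
      (0 < m → ∃ k < m, s'.real 2 0 = e k ∧ s'.real 8 0 = f k ∧ ∀ r < m, f r ≤ f k))
      ?_ ?_ ?_).mono ?_ ?_
  · exact ⟨by simp [State.setNat_nat], (Frame.refl _ _ s).setNat _ _ (by simp), hs.real6, by simp⟩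
  · rintro m s' ⟨h4, hfr, -⟩
    exact ⟨h4, by simp [NExp.eval, hfr.nat 2 (by simp), hs.nat2]⟩
  · rintro m hm s' ⟨h4, hfr, hz, hmax⟩
    have hs' := hs.frame hfr (by decide) (by decide) hz
    refine (Run.seq (T := 30)
      (T' := n * ((N - 1) * (60 * (A + 1) + n * (60 * (A + 1) + 61) + 83) + 21) + 20 + 30)
      ((capacityProgram_run hlo hs'.real0).mono le_rfl ?_)).mono (by omega) fun _ h => h
    rintro s₁ ⟨f₁, b₁⟩
    refine Run.seq ((valueProgram_run (hs'.frame f₁ (by decide) (by decide) ?_) ha ?_).mono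
      le_rfl ?_)
    · intro j hj
      rw [f₁.real 6 (by simp), hz j hj]
    · rw [b₁]
      exact max_le (hlo.trans hhi) ((min_le_right _ _).trans hhi)
    rintro s₂ ⟨f₂, z₂, v₂⟩
    refine (updateProgram_run (m := m) f e ?_ ?_ ?_ ?_).mono le_rfl ?_
    · rw [f₂.nat 4 (by simp), f₁.nat 4 (by simp), h4]
    · rw [f₂.real 2 (by simp), f₁.real 2 (by simp), f₂.real 8 (by simp), f₁.real 8 (by simp)]
      exact hmax
    · rw [v₂, b₁, h4]
    · rw [f₂.real 4 (by simp), b₁, h4]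
    rintro s₃ ⟨f₃, v₃⟩
    refine ⟨?_, ?_, ?_, ?_, fun _ => v₃⟩
    · rw [f₃.nat 4 (by simp), f₂.nat 4 (by simp), f₁.nat 4 (by simp), h4]
    · simp [State.setNat_nat]
    · exact (((hfr.trans (f₁.mono (by simp) (by simp))).trans (f₂.mono (by simp) (by simp))).trans
        (f₃.mono (by simp) (by simp))).setNat _ _ (by simp)
    · intro j hj
      rw [State.setNat_real, f₃.real 6 (by simp), z₂ j hj]
  · simp only [NExp.cost]
    set T := n * ((N - 1) * (60 * (A + 1) + n * (60 * (A + 1) + 61) + 83) + 21)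
    linarith
  · rintro s' ⟨-, -, -, h⟩
    obtain ⟨k, hk, h2, -, hmax⟩ := h (by omega)
    exact ⟨k, hk, h2, hmax⟩

theorem sumProgram_run {s : State} (hn : s.nat 0 0 = n) (h2 : s.nat 2 0 = 0)
    (h3 : s.real 3 0 = 0) :
    Run F Q sumProgram s (n * 50 + 10) fun s' => Frame [2, 5] [3] s s' ∧
      s'.nat 2 0 = ∑ i ∈ Finset.range n, s.nat 1 i ∧
      s'.real 3 0 = ∑ i ∈ Finset.range n, |s.real 1 i| := by
  refine (Run.forLoop (M := n) (T := 39) (fun m s' => s'.nat 5 0 = m ∧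
    Frame [2, 5] [3] s s' ∧ s'.nat 2 0 = ∑ i ∈ Finset.range m, s.nat 1 i ∧
      s'.real 3 0 = ∑ i ∈ Finset.range m, |s.real 1 i|) ?_ ?_ ?_).mono ?_ ?_
  · exact ⟨by simp [State.setNat_nat], (Frame.refl _ _ s).setNat _ _ (by simp),
      by simp [State.setNat_nat, h2], by simp [h3]⟩
  · rintro m s' ⟨h5, hf, -⟩
    exact ⟨h5, by simp [NExp.eval, hf.nat 0 (by simp), hn]⟩
  · rintro m hm s' ⟨h5, hf, hA, hD⟩
    have e1 := hf.nat 1 (by simp)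
    have r1 := hf.real 1 (by simp)
    refine (Run.seq (Run.nset (Run.branch (T := 15) (fun h => ?_) fun h => ?_))).mono (by decide)
      fun _ h => h
    all_goals
      simp [BExp.holds, NExp.eval, RExp.eval, State.setNat_nat, h5, r1] at h
    · refine (Run.rset ⟨?_, ?_, ?_, ?_, ?_⟩).mono (by decide) fun _ h => h
      · simp [State.setNat_nat, h5]
      · simp [State.setNat_nat]
      · exact ((hf.setNat _ _ (by simp)).setReal _ _ (by simp)).setNat _ _ (by simp)
      · simp [State.setNat_nat, NExp.eval, hA, h5, e1, Finset.sum_range_succ]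
      · simp [State.setReal_real, State.setNat_nat, NExp.eval, RExp.eval, hD, h5, r1,
          Finset.sum_range_succ, abs_of_neg h, sub_eq_add_neg]
    · refine (Run.rset ⟨?_, ?_, ?_, ?_, ?_⟩).mono (by decide) fun _ h => h
      · simp [State.setNat_nat, h5]
      · simp [State.setNat_nat]
      · exact ((hf.setNat _ _ (by simp)).setReal _ _ (by simp)).setNat _ _ (by simp)
      · simp [State.setNat_nat, NExp.eval, hA, h5, e1, Finset.sum_range_succ]
      · simp [State.setReal_real, State.setNat_nat, NExp.eval, RExp.eval, hD, h5, r1,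
          Finset.sum_range_succ, abs_of_nonneg h]
  · simp only [NExp.cost]; omega
  · rintro s' ⟨-, h⟩
    exact h

/-- Without rounding, the ceiling is found by counting up to the first N with Nε ≥ 2D. The cost is
linear in N, which the search dominates. -/
theorem countProgram_run {s : State} {ε D : ℝ} (hε : 0 < ε) (h3 : s.nat 3 0 = 0)
    (h03 : s.real 0 3 = ε) (hD : s.real 3 0 = D) :
    Run F Q countProgram s (⌈2 * D / ε⌉₊ * 20 + 20) fun s' => Frame [3] [] s s' ∧
      s'.nat 3 0 = ⌈2 * D / ε⌉₊ := by
  refine (Run.loop (T := 6) (M := ⌈2 * D / ε⌉₊)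
    (fun m s' => Frame [3] [] s s' ∧ s'.nat 3 0 = m) ?_ ?_ ?_).mono
    ?_ fun _ h => h
  · rintro m hm s' ⟨hf, h3'⟩
    refine ⟨?_, (Run.nset ⟨hf.setNat _ _ (by simp), ?_⟩).mono (by decide) fun _ h => h⟩
    · rw [Nat.lt_ceil, lt_div_iff₀ hε] at hm
      simp [BExp.holds, RExp.eval, NExp.eval, h3', hf.real 0 (by simp), hf.real 3 (by simp), h03,
        hD]
      linarith
    · simp [State.setNat_nat, NExp.eval, h3']
  · rintro s' ⟨hf, h3'⟩
    have := Nat.le_ceil (2 * D / ε)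
    rw [div_le_iff₀ hε] at this
    simp [BExp.holds, RExp.eval, NExp.eval, h3', hf.real 0 (by simp), hf.real 3 (by simp), h03,
        hD]
    linarith
  · exact ⟨Frame.refl _ _ _, h3⟩
  · simp only [BExp.cost, RExp.cost, NExp.cost]
    omega

/-- Running time and result of the approximation scheme. -/
theorem schemeProgram_run {s : State} {ε D : ℝ} (hn : s.nat 0 0 = n) (h1 : s.nat 1 = a)
    (hr1 : s.real 1 = d) (hr0 : s.real 0 = par) (h20 : s.nat 2 0 = 0) (h30 : s.nat 3 0 = 0)
    (hr3 : s.real 3 0 = 0) (hr6 : ∀ j, s.real 6 j = 0) (hp3 : par 3 = ε) (hε : 0 < ε)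
    (hA : ∑ i ∈ Finset.range n, a i = A) (hD : ∑ i ∈ Finset.range n, |d i| = D)
    (ha : ∀ j < n, 0 < a j) (hlo : par 1 ≤ par 2) (hhi : par 2 ≤ A) :
    ∃ t s', Exec F Q schemeProgram s t s' ∧
      ((2 * D ≤ ε ∧ t ≤ n * 50 + 30 ∧ output s' = par 1) ∨
        (ε < 2 * D ∧ t ≤ n * 50 + ⌈2 * D / ε⌉₊ * 20 + 50 +
          (A + 1) * (n * ((⌈2 * D / ε⌉₊ - 1) *
            (60 * (A + 1) + n * (60 * (A + 1) + 61) + 83) + 21) + 94) ∧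
          ∃ k < A + 1, output s' = max (par 1) (min (k : ℝ) (par 2)) ∧ ∀ r < A + 1,
            approxValue F Q a d (par 0) n ⌈2 * D / ε⌉₊ (max (par 1) (min (r : ℝ) (par 2))) ≤
            approxValue F Q a d (par 0) n ⌈2 * D / ε⌉₊ (max (par 1) (min (k : ℝ) (par 2))))) := by
  obtain ⟨t₁, s₁, x₁, ht₁, f₁, hA₁, hD₁⟩ := sumProgram_run (F := F) (Q := Q) hn h20 hr3
  rw [h1, hA] at hA₁
  rw [hr1, hD] at hD₁
  have e0 := f₁.real 0 (by simp)
  have hc : (BExp.rlt (.load 0 (.const 3)) (.add (rvar 3) (rvar 3))).holds F Q s₁ ↔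
      ε < 2 * D := by
    simp [BExp.holds, NExp.eval, RExp.eval, e0, hr0, hp3, hD₁, two_mul]
  by_cases h : ε < 2 * D
  · obtain ⟨t₂, s₂, x₂, ht₂, f₂, hN⟩ := countProgram_run (F := F) (Q := Q) (s := s₁) (D := D) hε
      (by rw [f₁.nat 3 (by simp), h30]) (by rw [e0, hr0, hp3]) hD₁
    have f₃ : Frame [2, 3, 5] [3] s s₂ :=
      (f₁.mono (by simp) (by simp)).trans (f₂.mono (by simp) (by simp))
    have hs₂ : Ready n A ⌈2 * D / ε⌉₊ a par d s₂ :=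
      ⟨by rw [f₃.nat 0 (by simp), hn], by rw [f₃.nat 1 (by simp), h1],
        by rw [f₂.nat 2 (by simp), hA₁], hN, by rw [f₃.real 0 (by simp), hr0],
        by rw [f₃.real 1 (by simp), hr1], fun j _ => by rw [f₃.real 6 (by simp), hr6]⟩
    obtain ⟨t₃, s₃, x₃, ht₃, hmax⟩ := searchProgram_run (F := F) (Q := Q) hs₂ ha hlo hhi
    refine ⟨_, s₃, .seq x₁ (.branch_true (hc.2 h) (.seq x₂ x₃)), Or.inr ⟨h, ?_, hmax⟩⟩
    simp only [BExp.cost, RExp.cost, NExp.cost]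
    omega
  · refine ⟨_, _, .seq x₁ (.branch_false (mt hc.1 h) (.rset _ _ _ _)),
      Or.inl ⟨not_lt.1 h, ?_, ?_⟩⟩
    · simp only [BExp.cost, RExp.cost, NExp.cost]
      omega
    · simp [output, State.setReal_real, NExp.eval, RExp.eval, e0, hr0]

end verification

end BilevelKnapsack

namespace BilevelKnapsack

/-! ### Quantiles and integrals of monotone functions -/

section quantile

variable (μ : Measure ℝ)

theorem bddBelow_setOf_le_cdf {p : ℝ} (hp : 0 < p) : BddBelow {x : ℝ | p ≤ cdf μ x} := by
  obtain ⟨y, hy⟩ := ((tendsto_cdf_atBot μ).eventually (gt_mem_nhds hp)).exists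
  exact ⟨y, fun x hx => le_of_lt ((monotone_cdf μ).reflect_lt (lt_of_lt_of_le hy hx))⟩

theorem nonempty_setOf_le_cdf {p : ℝ} (hp : p < 1) : {x : ℝ | p ≤ cdf μ x}.Nonempty := by
  obtain ⟨y, hy⟩ := ((tendsto_cdf_atTop μ).eventually (lt_mem_nhds hp)).exists
  exact ⟨y, le_of_lt hy⟩

/-- Right continuity of the distribution function makes the infimum a minimum. -/
theorem le_cdf_quantile {p : ℝ} (hp : p ∈ Set.Ioo (0 : ℝ) 1) : p ≤ cdf μ (quantile μ p) := by
  have hc := ((cdf μ).right_continuous (quantile μ p)).mono Set.Ioi_subset_Ici_self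
  refine ge_of_tendsto hc (Filter.eventually_of_mem self_mem_nhdsWithin fun x hx => ?_)
  obtain ⟨y, hy, hyx⟩ := exists_lt_of_csInf_lt (nonempty_setOf_le_cdf μ hp.2) hx
  exact le_trans hy (monotone_cdf μ hyx.le)

theorem cdf_lt_of_lt_quantile {p x : ℝ} (hp : p ∈ Set.Ioo (0 : ℝ) 1) (hx : x < quantile μ p) :
    cdf μ x < p := by
  by_contra h
  exact absurd (csInf_le (bddBelow_setOf_le_cdf μ hp.1) (not_lt.1 h)) (not_le.2 hx)

theorem quantile_le_quantile {p p' : ℝ} (hp : 0 < p) (hp' : p' < 1) (h : p ≤ p') :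
    quantile μ p ≤ quantile μ p' :=
  csInf_le_csInf (bddBelow_setOf_le_cdf μ hp) (nonempty_setOf_le_cdf μ hp') fun _ hx => h.trans hx

variable [IsProbabilityMeasure μ]

/-- With atoms, neither tail at the quantile need have mass exactly 1 - p. The open tail bounds it
from below and, in the next lemma, the closed tail bounds it from above. -/
theorem measureReal_Ioi_quantile_le {p : ℝ} (hp : p ∈ Set.Ioo (0 : ℝ) 1) :
    μ.real (Set.Ioi (quantile μ p)) ≤ 1 - p := by
  rw [← Set.compl_Iic, probReal_compl_eq_one_sub measurableSet_Iic, ← cdf_eq_real]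
  linarith [le_cdf_quantile μ hp]

theorem le_measureReal_Ici_quantile {p : ℝ} (hp : p ∈ Set.Ioo (0 : ℝ) 1) :
    1 - p ≤ μ.real (Set.Ici (quantile μ p)) := by
  rw [← Set.compl_Iio, probReal_compl_eq_one_sub measurableSet_Iio]
  suffices μ.real (Set.Iio (quantile μ p)) ≤ p by linarith
  have hlt := fun x hx => (cdf_lt_of_lt_quantile μ (x := x) hp hx).le
  -- The quantile also mentions `μ` and is abstracted before `μ` is rewritten as the measure of its
  -- distribution function; the mass of the open lower ray is then a left limit.
  generalize quantile μ p = q at hlt ⊢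
  rw [measureReal_def, ← measure_cdf μ, StieltjesFunction.measure_Iio _ (tendsto_cdf_atBot μ),
    sub_zero]
  refine ENNReal.toReal_le_of_le_ofReal hp.1.le (ENNReal.ofReal_le_ofReal ?_)
  exact le_of_tendsto ((monotone_cdf μ).tendsto_leftLim _)
    (Filter.eventually_of_mem self_mem_nhdsWithin hlt)

/-- The integral of a monotone function with values in `[0,1]` is approximated from below, up to
`1 / N`, by the average of its values at the quantiles for multiples of `1 / N`. -/
theorem sum_quantile_le_integral {h : ℝ → ℝ} (hm : Monotone h) (h0 : ∀ x, 0 ≤ h x)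
    (h1 : ∀ x, h x ≤ 1) {N : ℕ} (hN : 0 < N) :
    ∑ k ∈ Finset.range (N - 1), h (quantile μ (((k + 1 : ℕ) : ℝ) / N)) / N ≤ ∫ x, h x ∂μ ∧
    ∫ x, h x ∂μ ≤
      ∑ k ∈ Finset.range (N - 1), h (quantile μ (((k + 1 : ℕ) : ℝ) / N)) / N + 1 / N := by
  obtain ⟨M, rfl⟩ : ∃ M, N = M + 1 := ⟨N - 1, by omega⟩
  set N : ℕ := M + 1 with hNdef
  have hNpos : (0 : ℝ) < N := by exact_mod_cast hN
  rw [show N - 1 = M from rfl]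
  set p : ℕ → ℝ := fun k => ((k + 1 : ℕ) : ℝ) / N with hpdef
  have hp : ∀ k < M, p k ∈ Set.Ioo (0 : ℝ) 1 := fun k hk =>
    ⟨by positivity, by rw [hpdef, div_lt_one hNpos]; exact_mod_cast (by omega : k + 1 < N)⟩
  set q : ℕ → ℝ := fun k => quantile μ (p k) with hq
  have hqm : ∀ k, k + 1 < M → q k ≤ q (k + 1) := fun k hk =>
    quantile_le_quantile μ (hp k (by omega)).1 (hp (k + 1) hk).2
      (div_le_div_of_nonneg_right (by push_cast; linarith) hNpos.le)
  have hint : Integrable h μ := by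
    refine Integrable.of_bound hm.measurable.aestronglyMeasurable 1 (.of_forall fun x => ?_)
    rw [Real.norm_of_nonneg (h0 x)]
    exact h1 x
  have hind : ∀ (c : ℝ) (S : Set ℝ), MeasurableSet S → Integrable (S.indicator fun _ => c) μ :=
    fun c S hS => (integrable_const c).indicator hS
  have hval : ∀ (c : ℝ) (S : Set ℝ), MeasurableSet S →
      ∫ x, S.indicator (fun _ => c) x ∂μ = μ.real S * c := fun c S hS => by
    rw [integral_indicator_const c hS, smul_eq_mul]
  constructor
  -- Lower bound: `h` dominates the step function with jumps h(qₖ) - h(qₖ₋₁) on [qₖ,∞), starting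
  -- from 0. These rays have mass at least 1 - pₖ, and Abel summation with steps 1/N gives the
  -- average; the boundary term vanishes as p_M = 1.
  · set H' : ℕ → ℝ := fun k => if k = 0 then 0 else h (q (k - 1)) with hH'
    have hH'le : ∀ k < M, H' k ≤ h (q k) := by
      rintro (_ | k) hk
      · simpa [hH'] using h0 _
      · simpa [hH'] using hm (hqm k hk)
    -- The bound by `H' m` is carried along because a new jump at `q m ≤ x` must start from at most
    -- `H' m`.
    have hpt : ∀ x, ∀ m ≤ M, ∑ k ∈ Finset.range m,
        (Set.Ici (q k)).indicator (fun _ => h (q k) - H' k) x ≤ min (h x) (H' m) := by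
      intro x m
      induction m with
      | zero => intro _; simpa [hH'] using h0 x
      | succ m ih =>
        intro hmM
        have ih' := le_min_iff.1 (ih (by omega))
        have hH := hH'le m (by omega)
        have hs : H' (m + 1) = h (q m) := by simp [hH']
        rw [Finset.sum_range_succ, hs, le_min_iff]
        by_cases hx : q m ≤ x
        · rw [Set.indicator_of_mem (Set.mem_Ici.2 hx)]
          have := hm hx
          constructor <;> linarith
        · rw [Set.indicator_of_notMem (by simpa using hx)]
          constructor <;> linarith
    have hid : ∀ m, ∑ k ∈ Finset.range m, (1 - p k) * (h (q k) - H' k) =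
        ∑ k ∈ Finset.range m, h (q k) / N + H' m * (1 - p m) := by
      intro m
      induction m with
      | zero => simp [hH']
      | succ m ih =>
        rw [Finset.sum_range_succ, Finset.sum_range_succ, ih]
        have h2 : p (m + 1) = p m + 1 / N := by
          simp only [hpdef]
          push_cast
          ring
        rw [h2, show H' (m + 1) = h (q m) by simp [hH']]
        ring
    calc ∑ k ∈ Finset.range M, h (q k) / N
        = ∑ k ∈ Finset.range M, (1 - p k) * (h (q k) - H' k) := by
          rw [hid]
          have : p M = 1 := div_self hNpos.ne'
          simp [this]
      _ ≤ ∑ k ∈ Finset.range M, μ.real (Set.Ici (q k)) * (h (q k) - H' k) :=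
          Finset.sum_le_sum fun k hk => by
            have hk' := Finset.mem_range.1 hk
            exact mul_le_mul_of_nonneg_right (le_measureReal_Ici_quantile μ (hp k hk'))
              (sub_nonneg.2 (hH'le k hk'))
      _ = ∫ x, ∑ k ∈ Finset.range M, (Set.Ici (q k)).indicator (fun _ => h (q k) - H' k) x ∂μ := by
          rw [integral_finsetSum _ fun k _ => hind _ _ measurableSet_Ici]
          exact Finset.sum_congr rfl fun k _ => (hval _ _ measurableSet_Ici).symm
      _ ≤ ∫ x, h x ∂μ :=
          integral_mono (integrable_finsetSum _ fun k _ => hind _ _ measurableSet_Ici) hint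
            fun x => (le_min_iff.1 (hpt x M le_rfl)).1
  -- Upper bound: the same with open rays and the top level 1 in place of a value beyond the last
  -- quantile. Here Abel summation leaves 1 - M/N = 1/N, which is the error term.
  · set H : ℕ → ℝ := fun k => if k < M then h (q k) else 1 with hH
    have hHm : ∀ k < M, H k ≤ H (k + 1) := by
      intro k hk
      by_cases hk' : k + 1 < M
      · simpa [hH, hk, hk'] using hm (hqm k hk')
      · simpa [hH, hk, hk'] using h1 _
    have hpt : ∀ x, ∀ m ≤ M, min (h x) (H m) ≤ H 0 + ∑ k ∈ Finset.range m,
        (Set.Ioi (q k)).indicator (fun _ => H (k + 1) - H k) x := by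
      intro x m
      induction m with
      | zero => simp
      | succ m ih =>
        intro hmM
        have ih' := ih (by omega)
        have hs : H m = h (q m) := by simp [hH, show m < M by omega]
        rw [Finset.sum_range_succ, min_le_iff]
        by_cases hx : q m < x
        · rw [Set.indicator_of_mem (Set.mem_Ioi.2 hx)]
          rw [min_eq_right (by rw [hs]; exact hm hx.le)] at ih'
          right
          linarith
        · rw [Set.indicator_of_notMem (by simpa using hx)]
          rw [min_eq_left (by rw [hs]; exact hm (not_lt.1 hx))] at ih'
          left
          linarith
    have hid : ∀ m, H 0 + ∑ k ∈ Finset.range m, (1 - p k) * (H (k + 1) - H k) =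
        ∑ k ∈ Finset.range m, H k / N + H m * (1 - m / N) := by
      intro m
      induction m with
      | zero => simp
      | succ m ih =>
        rw [Finset.sum_range_succ, Finset.sum_range_succ, ← add_assoc, ih]
        have h2 : ((m + 1 : ℕ) : ℝ) / N = m / N + 1 / N := by
          push_cast
          ring
        rw [show p m = m / N + 1 / N from h2, h2]
        ring
    calc ∫ x, h x ∂μ
        ≤ ∫ x, H 0 + ∑ k ∈ Finset.range M,
            (Set.Ioi (q k)).indicator (fun _ => H (k + 1) - H k) x ∂μ := by
          refine integral_mono hint ((integrable_const _).add
            (integrable_finsetSum _ fun k _ => hind _ _ measurableSet_Ioi)) fun x => ?_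
          have := hpt x M le_rfl
          rwa [min_eq_left (by simpa [hH] using h1 x)] at this
      _ = H 0 + ∑ k ∈ Finset.range M, μ.real (Set.Ioi (q k)) * (H (k + 1) - H k) := by
          rw [integral_add (integrable_const _)
            (integrable_finsetSum _ fun k _ => hind _ _ measurableSet_Ioi),
            integral_finsetSum _ fun k _ => hind _ _ measurableSet_Ioi]
          simp [hval]
      _ ≤ H 0 + ∑ k ∈ Finset.range M, (1 - p k) * (H (k + 1) - H k) := by
          refine add_le_add le_rfl (Finset.sum_le_sum fun k hk => ?_)
          have hk' := Finset.mem_range.1 hk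
          exact mul_le_mul_of_nonneg_right (measureReal_Ioi_quantile_le μ (hp k hk'))
            (sub_nonneg.2 (hHm k hk'))
      _ = ∑ k ∈ Finset.range M, h (q k) / N + 1 / N := by
          rw [hid]
          congr 1
          · exact Finset.sum_congr rfl fun k hk => by simp [hH, Finset.mem_range.1 hk]
          · simp only [hH, lt_irrefl, if_false, hNdef]
            field_simp
            push_cast
            ring

end quantile

/-! ### The follower's optimal solution -/

theorem clampUnit_nonneg (x : ℝ) : 0 ≤ clampUnit x := le_max_left _ _

theorem clampUnit_le_one (x : ℝ) : clampUnit x ≤ 1 := max_le zero_le_one (min_le_left _ _)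

theorem clampUnit_mono : Monotone clampUnit := fun _ _ h =>
  max_le_max le_rfl (min_le_min le_rfl h)

/-- Total size of the items of `T` preceding item `i` in the follower's order, if item `i` has value
`γ`. -/
noncomputable def load {n : ℕ} (K : Data n) (T : Finset (Fin n)) (i : Fin n) (γ : ℝ)
    (c : Fin n → ℝ) : ℕ :=
  ∑ j ∈ T, if K.a j * γ / K.a i < c j then K.a j else 0

section follower

variable {n : ℕ} (K : Data n) {c : Fin n → ℝ} {b : ℝ} {x : Fin n → ℝ}

theorem sum_mul_update (w x : Fin n → ℝ) (i : Fin n) (v : ℝ) :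
    ∑ j, w j * Function.update x i v j = ∑ j, w j * x j + w i * (v - x i) := by
  have h : ∀ j, w j * Function.update x i v j =
      w j * x j + if j = i then w i * (v - x i) else 0 := by
    intro j
    rcases eq_or_ne j i with rfl | hne
    · simp; ring
    · simp [hne]
  simp [h, Finset.sum_add_distrib]

/-- Otherwise discarding the item stays feasible and increases the value. -/
theorem eq_zero_of_neg (hx : x ∈ K.followerArgmax c b) {i : Fin n} (hi : c i < 0) : x i = 0 := by
  obtain ⟨⟨hbox, hcap⟩, hopt⟩ := hx
  have h := hopt (Function.update x i 0) ⟨fun j => ?_, ?_⟩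
  · rw [sum_mul_update] at h
    nlinarith [(hbox i).1]
  · rcases eq_or_ne j i with rfl | hne
    · simp
    · simpa [hne] using hbox j
  · rw [sum_mul_update]
    have := mul_nonneg (Nat.cast_nonneg (α := ℝ) (K.a i)) (hbox i).1
    linarith

/-- Otherwise spare capacity could be spent on the profitable item `i`. -/
theorem sum_eq_of_pos (hx : x ∈ K.followerArgmax c b) {i : Fin n} (hi : 0 < c i) (h1 : x i < 1) :
    ∑ j, (K.a j : ℝ) * x j = b := by
  obtain ⟨⟨hbox, hcap⟩, hopt⟩ := hx
  by_contra hne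
  have hlt := lt_of_le_of_ne hcap hne
  have ha : (0 : ℝ) < K.a i := by exact_mod_cast K.a_pos i
  set t := min (1 - x i) ((b - ∑ j, (K.a j : ℝ) * x j) / K.a i) with ht
  have ht0 : 0 < t := lt_min (by linarith) (div_pos (by linarith) ha)
  have ht1 : t ≤ 1 - x i := min_le_left _ _
  have ht2 : K.a i * t ≤ b - ∑ j, (K.a j : ℝ) * x j := by
    have := min_le_right (1 - x i) ((b - ∑ j, (K.a j : ℝ) * x j) / K.a i)
    rw [← ht, le_div_iff₀ ha] at this
    linarith
  have h := hopt (Function.update x i (x i + t)) ⟨fun j => ?_, ?_⟩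
  · rw [sum_mul_update] at h
    nlinarith
  · rcases eq_or_ne j i with rfl | hne
    · have := (hbox j).1
      simp only [Function.update_self]
      constructor <;> linarith
    · simpa [hne] using hbox j
  · rw [sum_mul_update]
    linarith

/-- Exchange argument: otherwise moving capacity from `i` to the more profitable `j` improves the
value. -/
theorem eq_one_or_eq_zero (hx : x ∈ K.followerArgmax c b) {i j : Fin n}
    (hij : c i / K.a i < c j / K.a j) : x j = 1 ∨ x i = 0 := by
  obtain ⟨⟨hbox, hcap⟩, hopt⟩ := hx
  by_contra! hne
  have hj1 := lt_of_le_of_ne (hbox j).2 hne.1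
  have hi0 := lt_of_le_of_ne (hbox i).1 hne.2.symm
  have hai : (0 : ℝ) < K.a i := by exact_mod_cast K.a_pos i
  have haj : (0 : ℝ) < K.a j := by exact_mod_cast K.a_pos j
  have hji : j ≠ i := by rintro rfl; exact lt_irrefl _ hij
  -- The transfer is measured in capacity, and is the largest one that keeps both items within
  -- [0,1].
  set t := min (K.a j * (1 - x j)) (K.a i * x i) with ht
  have ht0 : 0 < t := lt_min (mul_pos haj (by linarith)) (mul_pos hai hi0)
  have ht1 : t / K.a j ≤ 1 - x j := by
    rw [div_le_iff₀ haj]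
    linarith [min_le_left (K.a j * (1 - x j)) (K.a i * x i)]
  have ht2 : t / K.a i ≤ x i := by
    rw [div_le_iff₀ hai]
    linarith [min_le_right (K.a j * (1 - x j)) (K.a i * x i)]
  have hsum : ∀ w : Fin n → ℝ, ∑ l, w l * Function.update (Function.update x j (x j + t / K.a j)) i
      (x i - t / K.a i) l = ∑ l, w l * x l + w j / K.a j * t - w i / K.a i * t := by
    intro w
    rw [sum_mul_update, sum_mul_update, Function.update_of_ne hji.symm]
    ring
  have h := hopt (Function.update (Function.update x j (x j + t / K.a j)) i
    (x i - t / K.a i)) ⟨fun l => ?_, ?_⟩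
  · rw [hsum] at h
    nlinarith
  · have p1 : 0 < t / K.a j := div_pos ht0 haj
    have p2 : 0 < t / K.a i := div_pos ht0 hai
    rcases eq_or_ne l i with rfl | hli
    · have := (hbox l).2
      simp only [Function.update_self]
      constructor <;> linarith
    · rcases eq_or_ne l j with rfl | hlj
      · have := (hbox l).1
        simp only [Function.update_of_ne hli, Function.update_self]
        constructor <;> linarith
      · simpa [hli, hlj] using hbox l
  · rw [hsum, div_self hai.ne', div_self haj.ne']
    linarith

/-- The follower's optimal solution is the greedy one, if the profits are distinct and nonzero. -/
theorem eq_greedy (hx : x ∈ K.followerArgmax c b)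
    (hne : ∀ i j, i ≠ j → c i / (K.a i : ℝ) ≠ c j / (K.a j : ℝ)) (h0 : ∀ i, c i ≠ 0) (i : Fin n) :
    x i = if 0 < c i then
      clampUnit ((b - load K (Finset.univ.erase i) i (c i) c) / K.a i) else 0 := by
  split_ifs with hi
  swap
  · exact eq_zero_of_neg K hx (lt_of_le_of_ne (not_lt.1 hi) (h0 i))
  have hapos : ∀ j, (0 : ℝ) < K.a j := fun j => by exact_mod_cast K.a_pos j
  have hprec : ∀ j, (K.a j * c i / K.a i < c j ↔ c i / K.a i < c j / K.a j) := by
    intro j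
    rw [lt_div_iff₀ (hapos j)]
    ring_nf
  have hbox := hx.1.1
  have hcap := hx.1.2
  have hsplit : ∑ j, (K.a j : ℝ) * x j =
      K.a i * x i + ∑ j ∈ Finset.univ.erase i, (K.a j : ℝ) * x j :=
    (Finset.add_sum_erase _ _ (Finset.mem_univ i)).symm
  have hload : (load K (Finset.univ.erase i) i (c i) c : ℝ) =
      ∑ j ∈ Finset.univ.erase i, if K.a j * c i / K.a i < c j then (K.a j : ℝ) else 0 := by
    simp [load]
  -- If xᵢ = 1, all preceding items are full, so L + aᵢ ≤ b. If xᵢ < 1, the capacity is exhausted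
  -- and all items of smaller profit are absent, so b - L ≤ aᵢxᵢ; this is an equality when xᵢ > 0,
  -- since then the preceding items are full.
  rcases eq_or_lt_of_le (hbox i).2 with h1 | h1
  · have hle : (load K (Finset.univ.erase i) i (c i) c : ℝ) ≤
        ∑ j ∈ Finset.univ.erase i, (K.a j : ℝ) * x j := by
      rw [hload]
      refine Finset.sum_le_sum fun j _ => ?_
      split_ifs with hj
      · rcases eq_one_or_eq_zero K hx ((hprec j).1 hj) with h | h
        · simp [h]
        · linarith
      · exact mul_nonneg (hapos j).le (hbox j).1
    rw [clampUnit_eq_one, h1]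
    rw [le_div_iff₀ (hapos i)]
    rw [hsplit, h1] at hcap
    linarith
  · have hsum := sum_eq_of_pos K hx hi h1
    have hle : ∑ j ∈ Finset.univ.erase i, (K.a j : ℝ) * x j ≤
        (load K (Finset.univ.erase i) i (c i) c : ℝ) := by
      rw [hload]
      refine Finset.sum_le_sum fun j hj => ?_
      split_ifs with hj'
      · nlinarith [(hbox j).2, hapos j]
      · rw [hprec, not_lt] at hj'
        have hlt := lt_of_le_of_ne hj' (hne j i (Finset.ne_of_mem_erase hj))
        rcases eq_one_or_eq_zero K hx hlt with h | h
        · linarith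
        · simp [h]
    rw [hsplit] at hsum
    rcases eq_or_lt_of_le (hbox i).1 with h2 | h2
    · rw [clampUnit_eq_zero, h2]
      refine div_nonpos_of_nonpos_of_nonneg ?_ (hapos i).le
      rw [← h2] at hsum
      linarith
    · have hge : (load K (Finset.univ.erase i) i (c i) c : ℝ) ≤
          ∑ j ∈ Finset.univ.erase i, (K.a j : ℝ) * x j := by
        rw [hload]
        refine Finset.sum_le_sum fun j hj => ?_
        split_ifs with hj'
        · rcases eq_one_or_eq_zero K hx ((hprec j).1 hj') with h | h
          · simp [h]
          · linarith
        · exact mul_nonneg (hapos j).le (hbox j).1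
      have : (b - load K (Finset.univ.erase i) i (c i) c) / K.a i = x i := by
        rw [div_eq_iff (hapos i).ne']
        linarith
      rw [this, clampUnit_eq_self h2.le h1.le]

end follower

end BilevelKnapsack

namespace BilevelKnapsack

/-! ### The leader's expected objective value -/

section independence

variable {n : ℕ} {ν : Measure (Fin n → ℝ)} [IsProbabilityMeasure ν]

instance isProbabilityMeasure_marginal (i : Fin n) : IsProbabilityMeasure (marginal ν i) :=
  Measure.isProbabilityMeasure_map (measurable_pi_apply i).aemeasurable

/-- Conditioning on one of several independent components. -/
theorem integral_condition (hν : iIndepFun (fun (i : Fin n) (c : Fin n → ℝ) => c i) ν)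
    {T : Finset (Fin n)} {i : Fin n} (hi : i ∉ T) {Φ : ℝ → (Fin n → ℝ) → ℝ}
    (hm : Measurable (Function.uncurry Φ)) {B : ℝ} (hB : ∀ γ c, |Φ γ c| ≤ B)
    (hT : ∀ γ c c', (∀ j ∈ T, c j = c' j) → Φ γ c = Φ γ c') :
    ∫ c, Φ (c i) c ∂ν = ∫ γ, ∫ c, Φ γ c ∂ν ∂(marginal ν i) := by
  set r : (Fin n → ℝ) → (T → ℝ) := fun c j => c j with hr
  set e : (T → ℝ) → Fin n → ℝ := fun z j => if h : j ∈ T then z ⟨j, h⟩ else 0 with he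
  have hrm : Measurable r := measurable_pi_lambda _ fun j => measurable_pi_apply _
  have hem : Measurable e := by
    refine measurable_pi_lambda _ fun j => ?_
    by_cases h : j ∈ T
    · simpa [he, h] using measurable_pi_apply _
    · simp [he, h]
  have hre : ∀ γ c, Φ γ (e (r c)) = Φ γ c := fun γ c =>
    hT _ _ _ fun j hj => by simp [he, hr, hj]
  -- `Φ γ` factors through the restriction `r` to `T`, which is independent of the `i`-th
  -- coordinate; the joint law is a product and Fubini applies.
  have hind : IndepFun (fun c : Fin n → ℝ => c i) r ν := by
    have h := hν.indepFun_finset {i} T (by simpa using hi) fun j => measurable_pi_apply j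
    exact h.comp (φ := fun z : ({i} : Finset (Fin n)) → ℝ => z ⟨i, by simp⟩) (ψ := id)
      (measurable_pi_apply _) measurable_id
  have hmap := hind.map_prod_eq_prod_map_map (measurable_pi_apply i).aemeasurable
    hrm.aemeasurable
  have hm' : Measurable fun z : ℝ × (T → ℝ) => Φ z.1 (e z.2) :=
    hm.comp (measurable_fst.prodMk (hem.comp measurable_snd))
  have : IsProbabilityMeasure (ν.map r) := Measure.isProbabilityMeasure_map hrm.aemeasurable
  calc ∫ c, Φ (c i) c ∂ν = ∫ c, Φ (c i) (e (r c)) ∂ν := by simp_rw [hre]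
    _ = ∫ z, Φ z.1 (e z.2) ∂(ν.map fun c => (c i, r c)) :=
        (integral_map ((measurable_pi_apply i).prodMk hrm).aemeasurable
          hm'.aestronglyMeasurable).symm
    _ = ∫ z, Φ z.1 (e z.2) ∂((marginal ν i).prod (ν.map r)) := by rw [hmap, marginal]
    _ = ∫ γ, ∫ z, Φ γ (e z) ∂(ν.map r) ∂(marginal ν i) :=
        integral_prod _ (Integrable.of_bound hm'.aestronglyMeasurable B
          (.of_forall fun z => hB _ _))
    _ = ∫ γ, ∫ c, Φ γ c ∂ν ∂(marginal ν i) := by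
        refine integral_congr_ae (.of_forall fun γ => ?_)
        simp only
        have hγ : Measurable fun z : T → ℝ => Φ γ (e z) := hm'.comp measurable_prodMk_left
        rw [integral_map hrm.aemeasurable hγ.aestronglyMeasurable]
        simp_rw [hre]

end independence

/-! ### The dynamic program and the quantile average as expectations -/

section load

variable {n : ℕ} (K : Data n)

theorem measurable_load (T : Finset (Fin n)) (i : Fin n) :
    Measurable (Function.uncurry fun (γ : ℝ) (c : Fin n → ℝ) => load K T i γ c) := by
  simp only [load, Function.uncurry_def]
  refine Finset.measurable_sum _ fun j _ => Measurable.ite ?_ measurable_const measurable_const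
  exact measurableSet_lt (by fun_prop) (by fun_prop)

theorem load_anti (T : Finset (Fin n)) (i : Fin n) (c : Fin n → ℝ) {γ γ' : ℝ} (h : γ ≤ γ') :
    load K T i γ' c ≤ load K T i γ c := by
  refine Finset.sum_le_sum fun j _ => ?_
  split_ifs with h1 h2 h2
  · exact le_rfl
  · refine absurd (lt_of_le_of_lt ?_ h1) h2
    gcongr
  · exact Nat.zero_le _
  · exact le_rfl

theorem load_congr {T : Finset (Fin n)} (i : Fin n) (γ : ℝ) {c c' : Fin n → ℝ}
    (h : ∀ j ∈ T, c j = c' j) : load K T i γ c = load K T i γ c' :=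
  Finset.sum_congr rfl fun j hj => by rw [h j hj]

/-- Amount of item `i` packed if it has value `γ`, an amount `s` of the capacity `b` is already used
and only items of `T` may precede item `i`. -/
noncomputable def fill (b : ℝ) (T : Finset (Fin n)) (i : Fin n) (s : ℕ) (γ : ℝ)
    (c : Fin n → ℝ) : ℝ :=
  clampUnit ((b - (s + load K T i γ c : ℕ)) / K.a i)

theorem measurable_fill (b : ℝ) (T : Finset (Fin n)) (i : Fin n) (s : ℕ) :
    Measurable (Function.uncurry (fill K b T i s)) := by
  have h := measurable_load K T i
  -- The load is a natural number, so any function of it is measurable.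
  have h2 : Measurable fun m : ℕ => clampUnit ((b - (s + m : ℕ)) / K.a i) := measurable_from_nat
  exact h2.comp h

theorem measurable_fill_right (b : ℝ) (T : Finset (Fin n)) (i : Fin n) (s : ℕ) (γ : ℝ) :
    Measurable (fill K b T i s γ) :=
  (measurable_fill K b T i s).of_uncurry_left

theorem abs_fill_le (b : ℝ) (T : Finset (Fin n)) (i : Fin n) (s : ℕ) (γ : ℝ) (c : Fin n → ℝ) :
    |fill K b T i s γ c| ≤ 1 := by
  rw [fill, abs_of_nonneg (clampUnit_nonneg _)]
  exact clampUnit_le_one _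

variable {ν : Measure (Fin n → ℝ)} [IsProbabilityMeasure ν]

theorem integrable_fill (b : ℝ) (T : Finset (Fin n)) (i : Fin n) (s : ℕ) (γ : ℝ) :
    Integrable (fill K b T i s γ) ν :=
  Integrable.of_bound (measurable_fill_right K b T i s γ).aestronglyMeasurable 1
    (.of_forall fun c => abs_fill_le K b T i s γ c)

/-- The amount `fill` over `T` ignores coordinate `l`, so after conditioning on `c l` the inner
integral is a constant factor. -/
theorem integral_mul_fill (hν : iIndepFun (fun (i : Fin n) (c : Fin n → ℝ) => c i) ν)
    {T : Finset (Fin n)} {l : Fin n} (hl : l ∉ T) (b : ℝ) (i : Fin n) (γ : ℝ) {g : ℝ → ℝ}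
    (hg : Measurable g) (hg1 : ∀ x, |g x| ≤ 1) (s : ℕ) :
    ∫ c, g (c l) * fill K b T i s γ c ∂ν =
      (∫ x, g x ∂(marginal ν l)) * ∫ c, fill K b T i s γ c ∂ν := by
  have h := integral_condition hν hl (Φ := fun x c => g x * fill K b T i s γ c) (B := 1)
    ?_ ?_ ?_
  · rw [h]
    simp only [integral_const_mul, integral_mul_const]
  · exact (hg.comp measurable_fst).mul ((measurable_fill_right K b T i s γ).comp measurable_snd)
  · intro x c
    rw [abs_mul]
    exact mul_le_one₀ (hg1 x) (abs_nonneg _) (abs_fill_le K b T i s γ c)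
  · intro x c c' h
    simp only [fill, load_congr K i γ h]

theorem integrable_mul_fill (b : ℝ) (T : Finset (Fin n)) (i l : Fin n) (γ : ℝ) {g : ℝ → ℝ}
    (hg : Measurable g) (hg1 : ∀ x, |g x| ≤ 1) (s : ℕ) :
    Integrable (fun c => g (c l) * fill K b T i s γ c) ν :=
  (integrable_fill K b T i s γ).bdd_mul (c := 1)
    (hg.comp (measurable_pi_apply l)).aestronglyMeasurable (.of_forall fun _ => hg1 _)

variable {F : ℕ → ℝ → ℝ} {a : ℕ → ℕ}

/-- The dynamic program computes expected values. -/
theorem packDP_eq_integral (hν : iIndepFun (fun (i : Fin n) (c : Fin n → ℝ) => c i) ν)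
    (hF : IsCdfOracle ν F) (ha : ∀ i : Fin n, a i = K.a i) (b : ℝ) (i : Fin n) (γ : ℝ) (m : ℕ)
    (hmn : m ≤ n) : ∀ s : ℕ, packDP F a b i γ m s =
      ∫ c, fill K b (Finset.univ.filter fun j : Fin n => j.1 < m ∧ j ≠ i) i s γ c ∂ν := by
  induction m with
  | zero =>
    intro s
    simp [packDP, fill, load, ha]
  | succ m ih =>
    intro s
    set T : Finset (Fin n) := Finset.univ.filter fun j : Fin n => j.1 < m ∧ j ≠ i with hT
    obtain ⟨l, hl⟩ : ∃ l : Fin n, l.1 = m := ⟨⟨m, by omega⟩, rfl⟩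
    rw [packDP, ih (by omega), ih (by omega)]
    by_cases hli : l = i
    -- Item `i` does not precede itself: the set is unchanged and the recursion has probability 0.
    · have hT' : (Finset.univ.filter fun j : Fin n => j.1 < m + 1 ∧ j ≠ i) = T := by
        ext j
        simp only [hT, Finset.mem_filter, Finset.mem_univ, true_and]
        refine and_congr_left fun hj => ?_
        have : j.1 ≠ l.1 := fun h => hj ((Fin.ext h).trans hli)
        omega
      rw [hT', precedeProb, if_pos (by rw [← hl, hli])]
      simp
    · have hlT : l ∉ T := by simp [hT, hl]
      have hT' : (Finset.univ.filter fun j : Fin n => j.1 < m + 1 ∧ j ≠ i) = insert l T := by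
        ext j
        simp only [hT, Finset.mem_filter, Finset.mem_univ, true_and, Finset.mem_insert, Fin.ext_iff,
          hl]
        have : i.1 ≠ m := fun h => hli (Fin.ext (hl.trans h.symm))
        omega
      set S : Set ℝ := Set.Ioi (K.a l * γ / K.a i) with hS
      -- Item `l` either precedes `i` and uses up `a l`, or leaves the load unchanged; taking
      -- expectations of this split gives the recursion.
      have hstep : ∀ c, fill K b (insert l T) i s γ c =
          S.indicator 1 (c l) * fill K b T i (s + K.a l) γ c +
          (1 - S.indicator 1 (c l)) * fill K b T i s γ c := by
        intro c
        by_cases hc : c l ∈ S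
        · rw [Set.indicator_of_mem hc, fill, load, Finset.sum_insert hlT, if_pos (Set.mem_Ioi.1 hc)]
          simp [fill, load, add_assoc]
        · rw [Set.indicator_of_notMem hc, fill, load, Finset.sum_insert hlT,
            if_neg (mt Set.mem_Ioi.2 hc)]
          simp [fill, load]
      have hindm : Measurable (S.indicator (1 : ℝ → ℝ)) :=
        measurable_one.indicator measurableSet_Ioi
      have hind1 : ∀ x, |S.indicator (1 : ℝ → ℝ) x| ≤ 1 ∧ |1 - S.indicator (1 : ℝ → ℝ) x| ≤ 1 := by
        intro x
        by_cases hx : x ∈ S <;> simp [hx]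
      have hindm' : Measurable fun x => 1 - S.indicator (1 : ℝ → ℝ) x :=
        measurable_const.sub hindm
      have hpr : precedeProb F a i γ m = ∫ x, S.indicator (1 : ℝ → ℝ) x ∂(marginal ν l) := by
        rw [precedeProb, if_neg (by rw [← hl]; exact fun h => hli (Fin.ext h)),
          integral_indicator_one measurableSet_Ioi, ← Set.compl_Iic,
          probReal_compl_eq_one_sub measurableSet_Iic, ← cdf_eq_real, ← hF, ha, ← hl, ha]
      have hpr' : 1 - precedeProb F a i γ m =
          ∫ x, (1 - S.indicator (1 : ℝ → ℝ) x) ∂(marginal ν l) := by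
        rw [integral_sub (f := fun _ => (1 : ℝ)) (g := S.indicator 1) (integrable_const _)
          (Integrable.of_bound hindm.aestronglyMeasurable 1 (.of_forall fun x => (hind1 x).1)),
          ← hpr]
        simp
      rw [hT']
      simp_rw [hstep]
      rw [integral_add (integrable_mul_fill K b T i l γ hindm (fun x => (hind1 x).1) _)
        (integrable_mul_fill K b T i l γ hindm' (fun x => (hind1 x).2) _),
        integral_mul_fill K hν hlT b i γ hindm fun x => (hind1 x).1,
        integral_mul_fill K hν hlT b i γ hindm' fun x => (hind1 x).2, ← hpr',
        ← hpr, ← hl, ha]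

/-- Amount of item `i` packed by the greedy solution if it has value `γ`. -/
noncomputable def greedy (b : ℝ) (i : Fin n) (γ : ℝ) (c : Fin n → ℝ) : ℝ :=
  if 0 < γ then clampUnit ((b - load K (Finset.univ.erase i) i γ c) / K.a i) else 0

theorem measurable_greedy (b : ℝ) (i : Fin n) : Measurable (Function.uncurry (greedy K b i)) := by
  have h := measurable_fill K b (Finset.univ.erase i) i 0
  simp only [Function.uncurry_def, fill, zero_add] at h
  exact Measurable.ite (measurableSet_lt measurable_const measurable_fst) h measurable_const

theorem greedy_mem_Icc (b : ℝ) (i : Fin n) (γ : ℝ) (c : Fin n → ℝ) :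
    greedy K b i γ c ∈ Set.Icc (0 : ℝ) 1 := by
  unfold greedy
  split_ifs
  · exact ⟨clampUnit_nonneg _, clampUnit_le_one _⟩
  · simp

/-- Raising γ can only move other items behind `i` or make `i` worth packing. The quantile
approximation rests on this. -/
theorem greedy_mono (b : ℝ) (i : Fin n) (c : Fin n → ℝ) : Monotone fun γ => greedy K b i γ c := by
  intro γ γ' h
  by_cases hγ : 0 < γ
  · simp only [greedy, hγ, hγ.trans_le h, if_true]
    refine clampUnit_mono (div_le_div_of_nonneg_right ?_ (Nat.cast_nonneg _))
    have : (load K (Finset.univ.erase i) i γ' c : ℝ) ≤ load K (Finset.univ.erase i) i γ c := by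
      exact_mod_cast load_anti K _ i c h
    linarith
  · simp only [greedy, hγ, if_false]
    exact (greedy_mem_Icc K b i γ' c).1

theorem integrable_greedy (b : ℝ) (i : Fin n) (γ : ℝ) : Integrable (greedy K b i γ) ν := by
  refine Integrable.of_bound ((measurable_greedy K b i).comp
    measurable_prodMk_left).aestronglyMeasurable 1 (.of_forall fun c => ?_)
  have h := greedy_mem_Icc K b i γ c
  rw [Real.norm_of_nonneg h.1]
  exact h.2

theorem integrable_greedy_apply (b : ℝ) (i : Fin n) :
    Integrable (fun c => greedy K b i (c i) c) ν := by
  have h : Measurable fun c : Fin n → ℝ => (c i, c) := (measurable_pi_apply i).prodMk measurable_id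
  have hm : Measurable fun c => greedy K b i (c i) c := (measurable_greedy K b i).comp h
  refine Integrable.of_bound hm.aestronglyMeasurable 1 (.of_forall fun c => ?_)
  have h := greedy_mem_Icc K b i (c i) c
  rw [Real.norm_of_nonneg h.1]
  exact h.2

theorem packed_eq_integral (hν : iIndepFun (fun (i : Fin n) (c : Fin n → ℝ) => c i) ν)
    (hF : IsCdfOracle ν F) (ha : ∀ i : Fin n, a i = K.a i) (b : ℝ) (i : Fin n) (γ : ℝ) :
    packed F a n b i γ = ∫ c, greedy K b i γ c ∂ν := by
  by_cases hγ : 0 < γ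
  · have hT : (Finset.univ.filter fun j : Fin n => j.1 < n ∧ j ≠ i) = Finset.univ.erase i := by
      ext j
      simp
    rw [packed, if_pos hγ, packDP_eq_integral K hν hF ha b i γ n le_rfl, hT]
    simp [fill, greedy, hγ]
  · simp [packed, greedy, hγ]

/-- The expected amount of item `i` packed is approximated by an average over quantiles. -/
theorem integral_greedy_approx (hν : iIndepFun (fun (i : Fin n) (c : Fin n → ℝ) => c i) ν)
    (hF : IsCdfOracle ν F) {Q : ℕ → ℝ → ℝ} (hQ : IsQuantileOracle ν Q)
    (ha : ∀ i : Fin n, a i = K.a i) (b : ℝ) (i : Fin n) {N : ℕ} (hN : 0 < N) :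
    |∫ c, greedy K b i (c i) c ∂ν -
      ∑ k ∈ Finset.range (N - 1), packed F a n b i (Q i (((k + 1 : ℕ) : ℝ) / N)) / N| ≤ 1 / N := by
  have hNpos : (0 : ℝ) < N := by exact_mod_cast hN
  have hcond : ∫ c, greedy K b i (c i) c ∂ν =
      ∫ γ, packed F a n b i γ ∂(marginal ν i) := by
    simp_rw [packed_eq_integral K hν hF ha]
    refine integral_condition hν (Finset.notMem_erase i Finset.univ) (measurable_greedy K b i)
      (B := 1) (fun γ c => ?_) fun γ c c' h => ?_
    · have h := greedy_mem_Icc K b i γ c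
      rw [abs_of_nonneg h.1]
      exact h.2
    · simp only [greedy, load_congr K i γ h]
  have hmono : Monotone fun γ => packed F a n b i γ := by
    intro γ γ' h
    simp only [packed_eq_integral K hν hF ha]
    exact integral_mono (integrable_greedy K b i γ) (integrable_greedy K b i γ')
      fun c => greedy_mono K b i c h
  have h0 : ∀ γ, 0 ≤ packed F a n b i γ := fun γ => by
    rw [packed_eq_integral K hν hF ha]
    exact integral_nonneg fun c => (greedy_mem_Icc K b i γ c).1
  have h1 : ∀ γ, packed F a n b i γ ≤ 1 := fun γ => by
    rw [packed_eq_integral K hν hF ha]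
    refine (integral_mono (integrable_greedy K b i γ) (integrable_const (1 : ℝ))
      fun c => (greedy_mem_Icc K b i γ c).2).trans ?_
    simp
  have hq : ∑ k ∈ Finset.range (N - 1), packed F a n b i (Q i (((k + 1 : ℕ) : ℝ) / N)) / N =
      ∑ k ∈ Finset.range (N - 1),
        packed F a n b i (quantile (marginal ν i) (((k + 1 : ℕ) : ℝ) / N)) / N := by
    -- Since 0 < k + 1 < N, all queries fall into (0,1), where the oracle is specified.
    refine Finset.sum_congr rfl fun k hk => ?_
    rw [hQ i]
    have hk' := Finset.mem_range.1 hk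
    refine ⟨by positivity, ?_⟩
    rw [div_lt_one hNpos]
    exact_mod_cast (by omega : k + 1 < N)
  have h := sum_quantile_le_integral (marginal ν i) hmono h0 h1 hN
  rw [hcond, hq, abs_le]
  have : 0 ≤ 1 / (N : ℝ) := by positivity
  constructor <;> linarith [h.1, h.2]

end load

/-! ### Piecewise linearity in the capacity and the approximation error -/

section value

variable {n : ℕ} (K : Data n) {ν : Measure (Fin n → ℝ)}
  {x : (Fin n → ℝ) → ℝ → Fin n → ℝ}

/-- The leader's expected objective value for the greedy solution. -/
noncomputable def greedyValue (ν : Measure (Fin n → ℝ)) (b : ℝ) : ℝ :=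
  ∑ i, (K.d i : ℝ) * ∫ c, greedy K b i (c i) c ∂ν - K.δ * b

theorem value_ae_eq (hg : K.Generic ν) (hx : K.IsResponse x) {b : ℝ}
    (hb : b ∈ Set.Icc K.bLo K.bHi) :
    K.value x b =ᵐ[ν] fun c => ∑ i, (K.d i : ℝ) * greedy K b i (c i) c - K.δ * b := by
  have h1 : ∀ᵐ c ∂ν, ∀ i j, i ≠ j → c i / (K.a i : ℝ) ≠ c j / (K.a j : ℝ) := by
    rw [ae_all_iff]
    intro i
    rw [ae_all_iff]
    intro j
    by_cases hij : i = j
    · simp [hij]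
    · have : ∀ᵐ c ∂ν, c i / (K.a i : ℝ) ≠ c j / (K.a j : ℝ) := by
        rw [ae_iff]
        simpa using hg.1 i j hij
      filter_upwards [this] with c hc _ using hc
  have h2 : ∀ᵐ c ∂ν, ∀ i, c i ≠ 0 := by
    rw [ae_all_iff]
    intro i
    rw [ae_iff]
    simpa using hg.2 i
  filter_upwards [h1, h2] with c hc1 hc2
  simp only [Data.value]
  congr 1
  exact Finset.sum_congr rfl fun i _ => by rw [eq_greedy K (hx c b hb) hc1 hc2 i]; rfl

variable [IsProbabilityMeasure ν]

/-- The response is not assumed measurable in `c`; measurability comes from the almost sure equality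
with the greedy solution. -/
theorem integrable_value (hg : K.Generic ν) (hx : K.IsResponse x) {b : ℝ}
    (hb : b ∈ Set.Icc K.bLo K.bHi) : Integrable (K.value x b) ν := by
  rw [integrable_congr (value_ae_eq K hg hx hb)]
  exact (integrable_finsetSum _ fun i _ => (integrable_greedy_apply K b i).const_mul _).sub
    (integrable_const _)

theorem expectedValue_eq (hg : K.Generic ν) (hx : K.IsResponse x) {b : ℝ}
    (hb : b ∈ Set.Icc K.bLo K.bHi) : K.expectedValue ν x b = greedyValue K ν b := by
  rw [Data.expectedValue, integral_congr_ae (value_ae_eq K hg hx hb), integral_sub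
    (integrable_finsetSum _ fun i _ => (integrable_greedy_apply K b i).const_mul _)
    (integrable_const _), integral_finsetSum _ fun i _ =>
      (integrable_greedy_apply K b i).const_mul _]
  simp [greedyValue, integral_const_mul]

/-- The kinks in b are at the integers s and s + k, so a single branch of the clamp applies on all
of [m, m+1]. -/
theorem clampUnit_affine {m s k : ℕ} (hk : 0 < k) {b₀ b₁ t : ℝ}
    (h₀ : b₀ ∈ Set.Icc (m : ℝ) (m + 1)) (h₁ : b₁ ∈ Set.Icc (m : ℝ) (m + 1))
    (ht : t ∈ Set.Icc (0 : ℝ) 1) :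
    clampUnit (((1 - t) * b₀ + t * b₁ - s) / k) =
      (1 - t) * clampUnit ((b₀ - s) / k) + t * clampUnit ((b₁ - s) / k) := by
  have hk' : (0 : ℝ) < k := by exact_mod_cast hk
  have hb : (1 - t) * b₀ + t * b₁ ∈ Set.Icc (m : ℝ) (m + 1) :=
    convex_Icc _ _ h₀ h₁ (by linarith [ht.2]) ht.1 (by ring)
  rcases Nat.lt_or_ge m s with h | h
  · have hs : (m : ℝ) + 1 ≤ s := by exact_mod_cast h
    have z : ∀ b ∈ Set.Icc (m : ℝ) (m + 1), clampUnit ((b - s) / k) = 0 := fun b hb =>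
      clampUnit_eq_zero (div_nonpos_of_nonpos_of_nonneg (by linarith [hb.2]) hk'.le)
    rw [z _ hb, z _ h₀, z _ h₁]
    ring
  have hs : (s : ℝ) ≤ m := by exact_mod_cast h
  rcases Nat.lt_or_ge m (s + k) with h' | h'
  · have hsk : (m : ℝ) + 1 ≤ s + k := by exact_mod_cast h'
    have z : ∀ b ∈ Set.Icc (m : ℝ) (m + 1), clampUnit ((b - s) / k) = (b - s) / k := fun b hb =>
      clampUnit_eq_self (div_nonneg (by linarith [hb.1]) hk'.le)
        ((div_le_one hk').2 (by linarith [hb.2]))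
    rw [z _ hb, z _ h₀, z _ h₁]
    field_simp
    ring
  · have hsk : (s : ℝ) + k ≤ m := by exact_mod_cast h'
    have z : ∀ b ∈ Set.Icc (m : ℝ) (m + 1), clampUnit ((b - s) / k) = 1 := fun b hb =>
      clampUnit_eq_one ((one_le_div hk').2 (by linarith [hb.1]))
    rw [z _ hb, z _ h₀, z _ h₁]
    ring

theorem greedyValue_affine {m : ℕ} {b₀ b₁ t : ℝ} (h₀ : b₀ ∈ Set.Icc (m : ℝ) (m + 1))
    (h₁ : b₁ ∈ Set.Icc (m : ℝ) (m + 1)) (ht : t ∈ Set.Icc (0 : ℝ) 1) :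
    greedyValue K ν ((1 - t) * b₀ + t * b₁) =
      (1 - t) * greedyValue K ν b₀ + t * greedyValue K ν b₁ := by
  have hgr : ∀ i γ c, greedy K ((1 - t) * b₀ + t * b₁) i γ c =
      (1 - t) * greedy K b₀ i γ c + t * greedy K b₁ i γ c := by
    intro i γ c
    unfold greedy
    split_ifs
    · exact clampUnit_affine (K.a_pos i) h₀ h₁ ht
    · ring
  have hint : ∀ i, ∫ c, greedy K ((1 - t) * b₀ + t * b₁) i (c i) c ∂ν =
      (1 - t) * ∫ c, greedy K b₀ i (c i) c ∂ν + t * ∫ c, greedy K b₁ i (c i) c ∂ν := by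
    intro i
    simp_rw [hgr]
    rw [integral_add ((integrable_greedy_apply K b₀ i).const_mul _)
      ((integrable_greedy_apply K b₁ i).const_mul _), integral_const_mul, integral_const_mul]
  simp only [greedyValue, hint, mul_sub, Finset.mul_sum]
  have : ∑ i, (K.d i : ℝ) * ((1 - t) * ∫ c, greedy K b₀ i (c i) c ∂ν +
      t * ∫ c, greedy K b₁ i (c i) c ∂ν) =
      ∑ i, (1 - t) * ((K.d i : ℝ) * ∫ c, greedy K b₀ i (c i) c ∂ν) +
      ∑ i, t * ((K.d i : ℝ) * ∫ c, greedy K b₁ i (c i) c ∂ν) := by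
    rw [← Finset.sum_add_distrib]
    exact Finset.sum_congr rfl fun i _ => by ring
  rw [this]
  ring

/-- The objective function attains its maximum at an integer or at an end point of the domain. -/
theorem greedyValue_le_integer {b : ℝ} (hb : b ∈ Set.Icc K.bLo K.bHi) :
    ∃ r < K.A + 1, greedyValue K ν b ≤ greedyValue K ν (max K.bLo (min (r : ℝ) K.bHi)) := by
  have hb0 : 0 ≤ b := K.bLo_nonneg.trans hb.1
  have hbA : b ≤ (K.A : ℝ) := hb.2.trans K.bHi_le
  set m := ⌊b⌋₊ with hm
  have hmb : (m : ℝ) ≤ b := Nat.floor_le hb0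
  have hbm : b < m + 1 := Nat.lt_floor_add_one b
  have hmA : m ≤ K.A := by exact_mod_cast hmb.trans hbA
  -- If m = A, then b = A = b⁺ is itself a candidate. Otherwise b lies between the candidates from m
  -- and m + 1, which both lie in [m, m+1], and by affinity the better of the two is at least as
  -- good.
  rcases eq_or_lt_of_le hmA with h | h
  · refine ⟨m, by omega, le_of_eq ?_⟩
    have e1 : b = K.A := le_antisymm hbA (by rw [← h]; exact hmb)
    have e2 : K.bHi = K.A := le_antisymm K.bHi_le (e1 ▸ hb.2)
    rw [h, e2, min_self, max_eq_right (e2 ▸ K.bLo_le_bHi), e1]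
  · set b₀ := max K.bLo (min (m : ℝ) K.bHi) with hb₀
    set b₁ := max K.bLo (min ((m + 1 : ℕ) : ℝ) K.bHi) with hb₁
    have e0 : b₀ = max K.bLo m := by rw [hb₀, min_eq_left (hmb.trans hb.2)]
    have e1 : b₁ = min ((m + 1 : ℕ) : ℝ) K.bHi := by
      rw [hb₁, max_eq_right (le_min (by push_cast; linarith [hb.1]) K.bLo_le_bHi)]
    have i0 : b₀ ≤ b := by rw [e0]; exact max_le hb.1 hmb
    have i1 : b ≤ b₁ := by rw [e1]; exact le_min (by push_cast; linarith) hb.2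
    have j0 : (m : ℝ) ≤ b₀ := by rw [e0]; exact le_max_right _ _
    have j1 : b₁ ≤ m + 1 := by rw [e1]; exact (min_le_left _ _).trans (by push_cast; linarith)
    obtain ⟨t, ht, hbt⟩ : ∃ t ∈ Set.Icc (0 : ℝ) 1, b = (1 - t) * b₀ + t * b₁ := by
      rcases eq_or_lt_of_le (i0.trans i1) with h01 | h01
      · exact ⟨0, by simp, by linarith⟩
      · refine ⟨(b - b₀) / (b₁ - b₀), ⟨div_nonneg (by linarith) (by linarith),
          (div_le_one (by linarith)).2 (by linarith)⟩, ?_⟩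
        have : b₁ - b₀ ≠ 0 := by linarith
        field_simp
        ring
    have haff := greedyValue_affine K (ν := ν) (m := m) (b₀ := b₀) (b₁ := b₁)
      ⟨j0, by linarith⟩ ⟨by linarith, j1⟩ ht
    rw [← hbt] at haff
    rcases le_total (greedyValue K ν b₀) (greedyValue K ν b₁) with h' | h'
    · exact ⟨m + 1, by omega, by rw [haff]; nlinarith [ht.1, ht.2]⟩
    · exact ⟨m, by omega, by rw [haff]; nlinarith [ht.1, ht.2]⟩

/-- The price term is exact, and item `i` contributes an error of at most |dᵢ|/N. -/
theorem abs_greedyValue_sub_le {F Q : ℕ → ℝ → ℝ}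
    (hν : iIndepFun (fun (i : Fin n) (c : Fin n → ℝ) => c i) ν)
    (hF : IsCdfOracle ν F) (hQ : IsQuantileOracle ν Q) {a : ℕ → ℕ} {d : ℕ → ℝ}
    (ha : ∀ i : Fin n, a i = K.a i) (hd : ∀ i : Fin n, d i = K.d i) (b : ℝ) {N : ℕ} (hN : 0 < N) :
    |greedyValue K ν b - approxValue F Q a d K.δ n N b| ≤ (K.D : ℝ) / N := by
  have e : greedyValue K ν b - approxValue F Q a d K.δ n N b = ∑ i : Fin n, (K.d i : ℝ) *
      (∫ c, greedy K b i (c i) c ∂ν -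
        ∑ k ∈ Finset.range (N - 1), packed F a n b i (Q i (((k + 1 : ℕ) : ℝ) / N)) / N) := by
    rw [greedyValue, approxValue, ← Fin.sum_univ_eq_sum_range (fun i =>
      ∑ k ∈ Finset.range (N - 1), d i * packed F a n b i (Q i (((k + 1 : ℕ) : ℝ) / N)) / N)]
    simp only [mul_sub, Finset.sum_sub_distrib, Finset.mul_sum, hd, mul_div_assoc]
    ring
  rw [e]
  refine (Finset.abs_sum_le_sum_abs _ _).trans ?_
  rw [Data.D, Int.cast_sum, Finset.sum_div]
  refine Finset.sum_le_sum fun i _ => ?_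
  rw [abs_mul, Int.cast_abs, div_eq_mul_one_div]
  exact mul_le_mul_of_nonneg_left (integral_greedy_approx K hν hF hQ ha b i hN) (abs_nonneg _)

/-- Used when 2D ≤ ε: apart from the price, which is smallest at b⁻, capacities differ in value by
at most 2D. -/
theorem greedyValue_mem_Icc (b : ℝ) :
    greedyValue K ν b + K.δ * b ∈ Set.Icc (-(K.D : ℝ)) K.D := by
  rw [Set.mem_Icc, ← abs_le, greedyValue, sub_add_cancel]
  refine (Finset.abs_sum_le_sum_abs _ _).trans ?_
  rw [Data.D, Int.cast_sum]
  refine Finset.sum_le_sum fun i _ => ?_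
  rw [abs_mul, Int.cast_abs]
  refine mul_le_of_le_one_right (abs_nonneg _) ?_
  rw [abs_of_nonneg (integral_nonneg fun c => (greedy_mem_Icc K b i _ c).1)]
  refine (integral_mono (integrable_greedy_apply K b i) (integrable_const (1 : ℝ))
      fun c => (greedy_mem_Icc K b i _ c).2).trans ?_
  simp

end value

/-- The running time of the approximation scheme is within the bound. -/
theorem runningTime_le {n A N : ℕ} (hn : 1 ≤ n) (hA : n ≤ A) (hN : 2 ≤ N) :
    n * 50 + N * 20 + 50 +
      (A + 1) * (n * ((N - 1) * (60 * (A + 1) + n * (60 * (A + 1) + 61) + 83) + 21) + 94) ≤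
      1500 * (n ^ 2 * A ^ 2 * N) := by
  have hA1 : 1 ≤ A := hn.trans hA
  have hN1 : 1 ≤ N := by omega
  have hnA : 1 ≤ n * A := Nat.mul_pos hn hA1
  -- Lower-order terms are absorbed using 1 ≤ n ≤ A: 120 + 181 + 83 = 384, then 384 + 21 = 405 and
  -- 405 + 94 = 499. Doubling for A + 1 ≤ 2A and adding 50 + 20 + 50 stays below 1500.
  have h1 : 60 * (A + 1) + n * (60 * (A + 1) + 61) + 83 ≤ 384 * (n * A) := by nlinarith
  have h2 : (N - 1) * (60 * (A + 1) + n * (60 * (A + 1) + 61) + 83) + 21 ≤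
      405 * (n * A * N) := by
    have h3 := Nat.mul_le_mul (Nat.sub_le N 1) h1
    have : 1 ≤ n * A * N := Nat.mul_pos hnA hN1
    nlinarith
  have h4 : n * ((N - 1) * (60 * (A + 1) + n * (60 * (A + 1) + 61) + 83) + 21) + 94 ≤
      499 * (n ^ 2 * A * N) := by
    have h3 := Nat.mul_le_mul_left n h2
    have : 1 ≤ n ^ 2 * A * N := Nat.mul_pos (Nat.mul_pos (by positivity) hA1) hN1
    nlinarith
  have h5 := Nat.mul_le_mul (by omega : A + 1 ≤ 2 * A) h4
  have h6 : n ≤ n ^ 2 * A ^ 2 * N := by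
    calc n = n * 1 * 1 := by ring
      _ ≤ n ^ 2 * A ^ 2 * N := by gcongr <;> nlinarith
  have h7 : N ≤ n ^ 2 * A ^ 2 * N :=
    Nat.le_mul_of_pos_left _ (by positivity)
  have h8 : 1 ≤ n ^ 2 * A ^ 2 * N := hn.trans h6
  nlinarith

end BilevelKnapsack

/-! ### The approximation guarantee and its running time -/

theorem mainTheorem5 :
    ∃ (p : RealRAM.Program) (C : ℝ),
      ∀ (n : ℕ) (_ : 1 ≤ n) (K : BilevelKnapsack.Data n) (ε : ℝ) (_ : 0 < ε)
        (ν : Measure (Fin n → ℝ)) (_ : IsProbabilityMeasure ν)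
        (_ : iIndepFun (fun (i : Fin n) (c : Fin n → ℝ) => c i) ν)
        (_ : K.Generic ν)
        (F Q : ℕ → ℝ → ℝ)
        (_ : BilevelKnapsack.IsCdfOracle ν F) (_ : BilevelKnapsack.IsQuantileOracle ν Q),
        ∃ (t : ℕ) (s : RealRAM.State),
          RealRAM.Exec F Q p (K.input ε) t s ∧
          (t : ℝ) ≤ C * ((n : ℝ) ^ 3 * (K.A : ℝ) +
            1 / ε * (n : ℝ) ^ 4 * (K.A : ℝ) ^ 2 * (K.D : ℝ)) ∧
          BilevelKnapsack.output s ∈ Set.Icc K.bLo K.bHi ∧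
          ∀ x : (Fin n → ℝ) → ℝ → Fin n → ℝ, K.IsResponse x →
            (∀ b ∈ Set.Icc K.bLo K.bHi, Integrable (K.value x b) ν) ∧
            ∀ b ∈ Set.Icc K.bLo K.bHi,
              K.expectedValue ν x b ≤ K.expectedValue ν x (BilevelKnapsack.output s) + ε := by
  -- 6000 is 1500 from `runningTime_le` times 4 from N ≤ 4D/ε.
  refine ⟨BilevelKnapsack.schemeProgram, 6000, ?_⟩
  intro n hn K ε hε ν _ hν hg F Q hF hQ
  have ha : ∀ i : Fin n, (K.input ε).nat 1 i = K.a i := fun i => by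
    simp [BilevelKnapsack.Data.input]
  have hd : ∀ i : Fin n, (K.input ε).real 1 i = K.d i := fun i => by
    simp [BilevelKnapsack.Data.input]
  have hA : ∑ i ∈ Finset.range n, (K.input ε).nat 1 i = K.A := by
    rw [← Fin.sum_univ_eq_sum_range]
    simp only [ha, BilevelKnapsack.Data.A]
  have hD : ∑ i ∈ Finset.range n, |(K.input ε).real 1 i| = (K.D : ℝ) := by
    rw [← Fin.sum_univ_eq_sum_range (fun i => |(K.input ε).real 1 i|)]
    simp [hd, BilevelKnapsack.Data.D]
  have p0 : (K.input ε).real 0 0 = K.δ := by simp [BilevelKnapsack.Data.input]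
  have p1 : (K.input ε).real 0 1 = K.bLo := by simp [BilevelKnapsack.Data.input]
  have p2 : (K.input ε).real 0 2 = K.bHi := by simp [BilevelKnapsack.Data.input]
  have hD0 : (0 : ℝ) ≤ K.D := by
    rw [← hD]
    exact Finset.sum_nonneg fun i _ => abs_nonneg _
  have hnA : n ≤ K.A := by
    calc n = ∑ _i : Fin n, 1 := by simp
      _ ≤ K.A := Finset.sum_le_sum fun i _ => K.a_pos i
  have hn1 : (1 : ℝ) ≤ n := by exact_mod_cast hn
  have hnA' : (n : ℝ) ≤ K.A := by exact_mod_cast hnA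
  obtain ⟨t, s, hexec, hs⟩ := BilevelKnapsack.schemeProgram_run (F := F) (Q := Q) (s := K.input ε)
    (n := n) (A := K.A) (ε := ε) (D := K.D) (by simp [BilevelKnapsack.Data.input]) rfl rfl rfl
    (by simp [BilevelKnapsack.Data.input]) (by simp [BilevelKnapsack.Data.input])
    (by simp [BilevelKnapsack.Data.input]) (by simp [BilevelKnapsack.Data.input])
    (by simp [BilevelKnapsack.Data.input]) hε hA hD
    (fun j hj => by rw [ha ⟨j, hj⟩]; exact K.a_pos _) (by rw [p1, p2]; exact K.bLo_le_bHi)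
    (by rw [p2]; exact K.bHi_le)
  rw [p0, p1, p2] at hs
  refine ⟨t, s, hexec, ?_⟩
  rcases hs with ⟨hεD, ht, hout⟩ | ⟨hεD, ht, k, hk, hout, hmax⟩
  · have hlo : K.bLo ∈ Set.Icc K.bLo K.bHi := ⟨le_rfl, K.bLo_le_bHi⟩
    refine ⟨?_, hout ▸ hlo, fun x hx => ⟨fun b hb => BilevelKnapsack.integrable_value K hg hx hb,
      fun b hb => ?_⟩⟩
    -- Only the summation phase was run; its linear cost is covered by n³A.
    · have h1 : (t : ℝ) ≤ n * 50 + 30 := by exact_mod_cast ht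
      have h2 : (n : ℝ) ≤ (n : ℝ) ^ 3 * K.A := by
        calc (n : ℝ) = n * 1 := by ring
          _ ≤ (n : ℝ) ^ 3 * K.A := by
            gcongr
            · exact le_self_pow₀ hn1 (by norm_num)
            · linarith
      have h3 : 0 ≤ 1 / ε * (n : ℝ) ^ 4 * (K.A : ℝ) ^ 2 * (K.D : ℝ) := by positivity
      linarith
    · rw [BilevelKnapsack.expectedValue_eq K hg hx hb, hout,
        BilevelKnapsack.expectedValue_eq K hg hx hlo]
      have h1 := BilevelKnapsack.greedyValue_mem_Icc K (ν := ν) b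
      have h2 := BilevelKnapsack.greedyValue_mem_Icc K (ν := ν) K.bLo
      have h3 := mul_le_mul_of_nonneg_left hb.1 K.δ_nonneg
      linarith [h1.2, h2.1]
  · set N := ⌈2 * (K.D : ℝ) / ε⌉₊ with hN
    have hgt : 1 < 2 * (K.D : ℝ) / ε := (one_lt_div hε).2 hεD
    have hN2 : 2 ≤ N := by
      rw [hN]
      exact Nat.lt_ceil.2 (by exact_mod_cast hgt)
    have hNpos : (0 : ℝ) < N := by exact_mod_cast (by omega : 0 < N)
    have hmem : ∀ r : ℕ, max K.bLo (min (r : ℝ) K.bHi) ∈ Set.Icc K.bLo K.bHi := fun r =>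
      ⟨le_max_left _ _, max_le K.bLo_le_bHi (min_le_right _ _)⟩
    refine ⟨?_, hout ▸ hmem k, fun x hx => ⟨fun b hb => BilevelKnapsack.integrable_value K hg hx hb,
      fun b hb => ?_⟩⟩
    · have h1 : (t : ℝ) ≤ 1500 * ((n : ℝ) ^ 2 * (K.A : ℝ) ^ 2 * N) := by
        exact_mod_cast ht.trans (BilevelKnapsack.runningTime_le hn hnA hN2)
      -- Here 2D/ε > 1, so rounding up at most doubles it.
      have h2 : (N : ℝ) ≤ 4 * (1 / ε * K.D) := by
        have h3 := (Nat.ceil_lt_add_one (by linarith : 0 ≤ 2 * (K.D : ℝ) / ε)).le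
        have h4 : 2 * (K.D : ℝ) / ε = 2 * (1 / ε * K.D) := by ring
        rw [h4] at h3 hgt
        rw [hN, h4]
        linarith
      have h3 : (n : ℝ) ^ 2 * (K.A : ℝ) ^ 2 * N ≤
          (n : ℝ) ^ 4 * (K.A : ℝ) ^ 2 * (4 * (1 / ε * K.D)) := by
        gcongr
        norm_num
      have h4 : 0 ≤ (n : ℝ) ^ 3 * (K.A : ℝ) := by positivity
      linarith
    · rw [BilevelKnapsack.expectedValue_eq K hg hx hb, hout,
        BilevelKnapsack.expectedValue_eq K hg hx (hmem k)]
      -- The value at b is at most that at candidate r; passing to the approximate objective there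
      -- and back at the chosen candidate k costs ε/2 each.
      obtain ⟨r, hr, hbr⟩ := BilevelKnapsack.greedyValue_le_integer K (ν := ν) hb
      have hk' := BilevelKnapsack.abs_greedyValue_sub_le K hν hF hQ ha hd
        (max K.bLo (min (k : ℝ) K.bHi)) (by omega : 0 < N)
      have hr' := BilevelKnapsack.abs_greedyValue_sub_le K hν hF hQ ha hd
        (max K.bLo (min (r : ℝ) K.bHi)) (by omega : 0 < N)
      have hDN : (K.D : ℝ) / N ≤ ε / 2 := by
        have h := Nat.le_ceil (2 * (K.D : ℝ) / ε)
        rw [← hN, div_le_iff₀ hε] at h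
        rw [div_le_iff₀ hNpos]
        linarith
      have hkr := hmax r hr
      rw [abs_le] at hk' hr'
      linarith [hk'.1, hr'.2]
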